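/- For $\lambda\in\mathbb{R}$ and $0<\alpha\le 1$ let $L(\lambda,\alpha,s)$ denote the Lerch zeta-function: if $\lambda\notin\mathbb{Z}$, it is the sum of the convergent series $\sum_{n=0}^{\infty}e^{2\pi i\lambda n}(n+\alpha)^{-s}$ for $\operatorname{Re}s>0$; if $\lambda\in\mathbb{Z}$, it is the Hurwitz zeta-function $\zeta(s,\alpha)$, that is, the meromorphic continuation of $\sum_{n=0}^{\infty}(n+\alpha)^{-s}$ ($\operatorname{Re}s>1$), whose only singularity is a simple pole at $s=1$. Let $\lambda\in\mathbb{R}$, $0<\alpha\le1$, $\sigma_1>0$ and $\varepsilon_1>0$. Then there exist $T_0>0$ and $C>0$, depending only on $\lambda,\alpha,\sigma_1,\varepsilon_1$, such that for all $T\ge T_0$ and all real $\sigma$ with $\tfrac12+\varepsilon_1\le\sigma\le\sigma_1$ the function $t\mapsto\log^2|L(\lambda,\alpha,\sigma+it)|$ is integrable on $[0,T]$ and \[\int_0^T\log^2|L(\lambda,\alpha,\sigma+it)|\,dt\le C\,T .\] -/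

import Mathlib

open Filter Topology

/-- The partial sum `∑_{0 ≤ n < N} e^{2πiλn} / (n + α)^s` of the Lerch series. -/
noncomputable def lerchPartialSum (lam α : ℝ) (s : ℂ) (N : ℕ) : ℂ :=
  ∑ n ∈ Finset.range N,
    Complex.exp (2 * Real.pi * Complex.I * lam * n) / ((n : ℂ) + (α : ℂ)) ^ s

theorem lerch_exp_sum_bounded (lam : ℝ) (h : ¬ ∃ k : ℤ, (k : ℝ) = lam) : ∃ B, ∀ N : ℕ,
    ‖∑ n ∈ Finset.range N, Complex.exp (2 * Real.pi * Complex.I * lam * n)‖ ≤ B := by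
  set q := Complex.exp (2 * Real.pi * Complex.I * lam) with hq
  have h1 : q ≠ 1 := by
    intro h1
    rw [Complex.exp_eq_one_iff] at h1
    obtain ⟨k, hk⟩ := h1
    refine h ⟨k, ?_⟩
    have : (2 * Real.pi * Complex.I) * ((k : ℂ) - lam) = 0 := by linear_combination -hk
    rcases mul_eq_zero.1 this with h2 | h2
    · exact absurd h2 Complex.two_pi_I_ne_zero
    · exact_mod_cast sub_eq_zero.1 h2
  have hn : ‖q‖ = 1 := by
    rw [hq, Complex.norm_exp]; simp
  refine ⟨2 / ‖q - 1‖, fun N => ?_⟩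
  have : ∀ n : ℕ, Complex.exp (2 * Real.pi * Complex.I * lam * n) = q ^ n := by
    intro n; rw [hq, ← Complex.exp_nat_mul]; ring_nf
  simp only [this]
  rw [geom_sum_eq h1, norm_div]
  gcongr
  calc ‖q ^ N - 1‖ ≤ ‖q ^ N‖ + ‖(1 : ℂ)‖ := norm_sub_le _ _
    _ = 2 := by rw [norm_pow, hn]; norm_num

theorem lerch_cpow_sub_bound (α : ℝ) (hα : 0 < α) (s : ℂ) (hs : 0 < s.re) (n : ℕ) :
    ‖(((n + 1 : ℕ) : ℂ) + α) ^ (-s) - ((n : ℂ) + α) ^ (-s)‖ ≤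
      ‖s‖ * (n + α) ^ (-s.re - 1) := by
  have hpos : (0 : ℝ) < n + α := by positivity
  have := (convex_Icc ((n : ℝ) + α) (n + 1 + α)).norm_image_sub_le_of_norm_hasDerivWithin_le
    (f := fun x : ℝ => (x : ℂ) ^ (-s)) (f' := fun x : ℝ => (-s) * (x : ℂ) ^ (-s - 1))
    (C := ‖s‖ * (n + α) ^ (-s.re - 1)) (x := n + α) (y := n + 1 + α) ?_ ?_ ?_ ?_
  · push_cast at this ⊢
    refine this.trans (le_of_eq ?_)
    rw [show ((n : ℝ) + 1 + α - (n + α)) = 1 by ring]; simp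
  · intro x hx
    have hx0 : 0 < x := hpos.trans_le hx.1
    have h0 : -s ≠ 0 := by intro h; rw [neg_eq_zero] at h; simp [h] at hs
    exact (hasDerivAt_ofReal_cpow_const (x := x) hx0.ne' h0).hasDerivWithinAt
  · intro x hx
    have hx0 : 0 < x := hpos.trans_le hx.1
    rw [norm_mul, norm_neg, Complex.norm_cpow_eq_rpow_re_of_pos hx0]
    gcongr
    simp only [Complex.sub_re, Complex.neg_re, Complex.one_re]
    exact Real.rpow_le_rpow_of_nonpos hpos hx.1 (by linarith)
  · constructor <;> linarith
  · constructor <;> linarith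

/-- For `λ` not an integer the Lerch series converges in `Re s > 0`. -/
theorem exists_tendsto_lerchPartialSum (lam α : ℝ) (h : ¬ ∃ k : ℤ, (k : ℝ) = lam) (hα : 0 < α) (s : ℂ)
    (hs : 0 < s.re) : ∃ z, Tendsto (lerchPartialSum lam α s) atTop (𝓝 z) := by
  obtain ⟨B, hB⟩ := lerch_exp_sum_bounded lam h
  set G := fun N => ∑ n ∈ Finset.range N, Complex.exp (2 * Real.pi * Complex.I * lam * n) with hG
  set f := fun n : ℕ => ((n : ℂ) + α) ^ (-s) with hf
  have hsum : Summable fun n : ℕ => (f (n + 1) - f n) * G (n + 1) := by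
    have h1 : Summable fun n : ℕ => (((n : ℝ) + α) ^ (-s.re - 1)) := by
      have := (Real.summable_one_div_nat_add_rpow α (s.re + 1)).2 (by linarith)
      refine this.congr fun n => ?_
      have : (0 : ℝ) < n + α := by positivity
      rw [abs_of_pos this, one_div, ← Real.rpow_neg this.le]; ring_nf
    refine Summable.of_norm_bounded ((h1.mul_left ‖s‖).mul_right B) fun n => ?_
    rw [norm_mul]
    gcongr
    · have := lerch_cpow_sub_bound α hα s hs n
      simpa [hf] using this
    · exact hB _
  have hf0 : Tendsto f atTop (𝓝 0) := by
    rw [tendsto_zero_iff_norm_tendsto_zero]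
    have h2 : Tendsto (fun n : ℕ => ((n : ℝ) + α) ^ (-s.re)) atTop (𝓝 0) :=
      (tendsto_rpow_neg_atTop hs).comp
        (tendsto_atTop_add_const_right _ _ tendsto_natCast_atTop_atTop)
    refine h2.congr fun n => ?_
    have : (0 : ℝ) < n + α := by positivity
    have e : f n = (((n : ℝ) + α : ℝ) : ℂ) ^ (-s) := by simp [hf]
    rw [e, Complex.norm_cpow_eq_rpow_re_of_pos this]; simp
  have key : ∀ N, lerchPartialSum lam α s (N + 1) =
      f N * G (N + 1) - ∑ n ∈ Finset.range N, (f (n + 1) - f n) * G (n + 1) := by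
    intro N
    have := Finset.sum_range_by_parts f
      (fun n : ℕ => Complex.exp (2 * Real.pi * Complex.I * lam * n)) (N + 1)
    simp only [smul_eq_mul, Nat.add_sub_cancel] at this
    rw [← this]
    refine Finset.sum_congr rfl fun n _ => ?_
    simp only [hf]
    rw [Complex.cpow_neg, div_eq_mul_inv, mul_comm]
  have h3 : Tendsto (fun N => f N * G (N + 1)) atTop (𝓝 0) := by
    refine squeeze_zero_norm (a := fun N => ‖f N‖ * B) (fun N => ?_) ?_
    · rw [norm_mul]; gcongr; exact hB _
    · simpa using hf0.norm.mul_const B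
  exact ⟨_, (tendsto_add_atTop_iff_nat 1).1
    ((h3.sub hsum.hasSum.tendsto_sum_nat).congr fun N => (key N).symm)⟩

open Classical in
/-- The Lerch zeta-function `L(λ, α, s)` for real `λ` and `0 < α ≤ 1`.
If `λ` is not an integer it is the sum of the (in general only conditionally convergent)
series `∑_{n ≥ 0} e^{2πiλn} / (n + α)^s` in the half-plane `Re s > 0`.
If `λ` is an integer it is the Hurwitz zeta-function `ζ(s, α)`, the meromorphic continuation
of `∑_{n ≥ 0} 1 / (n + α)^s`, holomorphic except for a simple pole at `s = 1`. -/
noncomputable def lerchZeta (lam α : ℝ) (s : ℂ) : ℂ :=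
  if ∃ k : ℤ, (k : ℝ) = lam then HurwitzZeta.hurwitzZeta (α : UnitAddCircle) s
  else limUnder atTop (lerchPartialSum lam α s)

theorem tendsto_lerchPartialSum (lam α : ℝ) (h : ¬ ∃ k : ℤ, (k : ℝ) = lam) (hα : 0 < α)
    (s : ℂ) (hs : 0 < s.re) :
    Tendsto (lerchPartialSum lam α s) atTop (𝓝 (lerchZeta lam α s)) := by
  rw [lerchZeta, if_neg h]
  exact tendsto_nhds_limUnder (exists_tendsto_lerchPartialSum lam α h hα s hs)

theorem hasSum_lerchZeta_of_int (k : ℤ) (α : ℝ) (hα : 0 < α) (hα' : α ≤ 1) (s : ℂ)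
    (hs : 1 < s.re) :
    HasSum (fun n : ℕ => 1 / ((n : ℂ) + (α : ℂ)) ^ s) (lerchZeta k α s) := by
  rw [lerchZeta, if_pos ⟨k, rfl⟩]
  exact HurwitzZeta.hasSum_hurwitzZeta_of_one_lt_re ⟨hα.le, hα'⟩ hs

/-! The pole is removed by `G(s) = L(s)(s - 1)/(s + 1)`, holomorphic in `Re s > 0`. Off `t = 0`,
`|log |L||` exceeds `|log |G||` by at most `log (1 + 2/|t|)`, which is harmless in `L²`, so `log
|G|` is what matters.

Local bound (`exists_lintegral_log_sq_le_sq`). Take a disc centred at `σ₀ + in`, far to the right,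
where `|G| ≥ 1/9`, and let `M ≥ 1` bound `|G|` on it. Zeros in a slightly smaller disc are divided
out of `G/M` by Blaschke factors. Each division preserves the bound `1` and raises the central value
by a fixed factor, so only `O(1 + log M)` divisions can occur. Each zero costs a logarithmic
singularity of bounded `L²` norm, and Borel–Carathéodory handles the zero-free quotient. Hence `log²
|G|` has integral `O(M²)` over a unit segment.

Summation (`exists_lintegral_log_sq_le`). By the mean value inequality, `M²` can be taken as `1`
plus a constant times the area integral of `|G|²` over a box. The boxes overlap boundedly often, so
everything reduces to `∫_{-T}^{T} |G(σ + it)|² dt = O(T)`, uniformly for `1/2 + δ ≤ σ ≤ b`.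

Mean square (`exists_lintegral_mul_mellin_lerchRemainder_sq_le`). For `Re s > 0`, `L(s) = s ∫ S(x)
x^{-s-1} dx + E/(s - 1)` with `S` bounded. Multiplying the Mellin transform by `e^{hs} - 1` replaces
`S(x)` by `S(e^h x) - S(x)`. With `h` of order `1/T`, Plancherel bounds the mean square by `h^{-2} ∫
e^{2σu} |S(e^{h-u}) - S(e^{-u})|² du`. One factor of the difference is bounded; the weighted `L¹`
norm of the other is `O(h)`, as `S` has jumps of modulus one at the points `n + α` and slope at most
one in between, and `∑ (n + α)^{-2σ}` converges for `σ > 1/2`. The total is `O(1/h) = O(T)`. -/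

/-! ### Plancherel's theorem for the Fourier integral. -/

open MeasureTheory FourierTransform in
/-- **Plancherel's theorem** for the pointwise Fourier integral of functions in `L¹ ∩ L²`. -/
theorem eLpNorm_fourier_eq_of_integrable {f : ℝ → ℂ} (h1 : Integrable f) (h2 : MemLp f 2) :
    eLpNorm (𝓕 f) 2 volume = eLpNorm f 2 volume := by
  have hcont : Continuous (𝓕 f) :=
    VectorFourier.fourierIntegral_continuous Real.continuous_fourierChar
      (by exact continuous_inner) h1
  -- The `L²` transform and the Fourier integral define the same tempered distribution: in both
  -- pairings the transform moves onto `g`.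
  have hF2 : ∀ g : SchwartzMap ℝ ℂ, ∫ x, g x • (𝓕 (h2.toLp f) : Lp ℂ 2 (volume : Measure ℝ)) x
      = ∫ x, g x • 𝓕 f x := by
    intro g
    have e := congrArg (fun T => T g) (Lp.fourier_toTemperedDistribution_eq (h2.toLp f))
    simp only [TemperedDistribution.fourier_apply, Lp.toTemperedDistribution_apply] at e
    rw [← e]
    have e1 : ∫ x, (𝓕 g) x • (h2.toLp f) x = ∫ x, (𝓕 g) x • f x := by
      refine integral_congr_ae ?_
      filter_upwards [h2.coeFn_toLp] with x hx
      rw [hx]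
    rw [e1]
    have := VectorFourier.integral_fourierIntegral_smul_eq_flip (L := innerₗ ℝ)
      Real.continuous_fourierChar (by exact continuous_inner) g.integrable h1
      (μ := volume) (ν := volume)
    rw [flip_innerₗ] at this
    exact this
  have hae : (𝓕 (h2.toLp f) : Lp ℂ 2 (volume : Measure ℝ)) =ᵐ[volume] 𝓕 f := by
    have hloc : LocallyIntegrable
        (fun x => (𝓕 (h2.toLp f) : Lp ℂ 2 (volume : Measure ℝ)) x - 𝓕 f x) volume :=
      ((Lp.memLp _).locallyIntegrable (by norm_num)).sub hcont.locallyIntegrable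
    have := ae_eq_zero_of_integral_contDiff_smul_eq_zero hloc (fun g hg hgc => ?_)
    · filter_upwards [this] with x hx
      exact sub_eq_zero.1 hx
    · have hgc' : HasCompactSupport (fun x => (g x : ℂ)) :=
        hgc.comp_left (g := fun y : ℝ => (y : ℂ)) (by simp)
      have hg' : ContDiff ℝ (↑(⊤ : ℕ∞)) (fun x => (g x : ℂ)) :=
        Complex.ofRealCLM.contDiff.comp hg
      have e := hF2 (hgc'.toSchwartzMap hg')
      have hi1 : Integrable (fun x => g x • (𝓕 (h2.toLp f) : Lp ℂ 2 (volume : Measure ℝ)) x) :=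
        ((Lp.memLp _).locallyIntegrable (by norm_num)).integrable_smul_left_of_hasCompactSupport
          hg.continuous hgc
      have hi2 : Integrable (fun x => g x • 𝓕 f x) :=
        hcont.locallyIntegrable.integrable_smul_left_of_hasCompactSupport hg.continuous hgc
      simp only [smul_sub]
      rw [integral_sub hi1 hi2, sub_eq_zero]
      simpa using e
  rw [← eLpNorm_congr_ae hae]
  have := Lp.norm_fourier_eq (h2.toLp f)
  rw [Lp.norm_def, Lp.norm_def, ENNReal.toReal_eq_toReal_iff' (Lp.eLpNorm_ne_top _)
    (Lp.eLpNorm_ne_top _)] at this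
  rw [this, eLpNorm_congr_ae h2.coeFn_toLp]

/-! ### The logarithm of a bounded holomorphic function on a disc: Borel–Carathéodory and Blaschke
factors. -/

/-- A zero-free holomorphic function on a disc has a holomorphic logarithm. -/
theorem exists_differentiableOn_exp_eq_of_ne_zero {f : ℂ → ℂ} {R : ℝ} (hR : 0 < R)
    (hf : DifferentiableOn ℂ f (Metric.ball 0 R)) (h0 : ∀ z ∈ Metric.ball (0 : ℂ) R, f z ≠ 0) :
    ∃ g : ℂ → ℂ, DifferentiableOn ℂ g (Metric.ball 0 R) ∧
      ∀ z ∈ Metric.ball (0 : ℂ) R, Complex.exp (g z) = f z := by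
  have hd : DifferentiableOn ℂ (fun z => deriv f z / f z) (Metric.ball 0 R) :=
    (hf.deriv Metric.isOpen_ball).div hf h0
  obtain ⟨g, hg0, hg⟩ := hd.isExactOn_ball.with_val_at 0 (Complex.log (f 0))
  refine ⟨g, fun z hz => (hg z hz).differentiableAt.differentiableWithinAt, fun z hz => ?_⟩
  have hder : ∀ z ∈ Metric.ball (0 : ℂ) R,
      HasDerivAt (fun z => Complex.exp (-g z) * f z) 0 z := by
    intro z hz
    have h1 := (hg z hz).neg.cexp
    have h2 := ((hf z hz).differentiableAt (Metric.isOpen_ball.mem_nhds hz)).hasDerivAt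
    convert! h1.mul h2 using 1
    have := h0 z hz
    field_simp
    ring
  have hc := Metric.isOpen_ball.is_const_of_deriv_eq_zero
    (convex_ball (0 : ℂ) R).isPreconnected
    (fun z hz => (hder z hz).differentiableAt.differentiableWithinAt)
    (fun z hz => (hder z hz).deriv) hz (Metric.mem_ball_self hR)
  simp only [hg0] at hc
  rw [Complex.exp_neg, Complex.exp_neg, Complex.exp_log (h0 0 (Metric.mem_ball_self hR)),
    inv_mul_cancel₀ (h0 0 (Metric.mem_ball_self hR)), inv_mul_eq_one₀ (Complex.exp_ne_zero _)] at hc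
  exact hc

/-- A Harnack type inequality for the logarithm of a zero-free holomorphic function. -/
theorem abs_log_norm_le_of_ne_zero {f : ℂ → ℂ} {R r M : ℝ} (hR : r < R) (hM : 0 < M)
    (hf : DifferentiableOn ℂ f (Metric.ball 0 R)) (h0 : ∀ z ∈ Metric.ball (0 : ℂ) R, f z ≠ 0)
    (h1 : ∀ z ∈ Metric.ball (0 : ℂ) R, ‖f z‖ ≤ 1) (hfM : Real.exp (-M) ≤ ‖f 0‖)
    {z : ℂ} (hz : ‖z‖ ≤ r) :
    |Real.log ‖f z‖| ≤ M * (1 + 2 * r / (R - r)) := by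
  have hr0 : 0 ≤ r := (norm_nonneg z).trans hz
  have hR0 : 0 < R := by linarith
  obtain ⟨g, hg, hgf⟩ := exists_differentiableOn_exp_eq_of_ne_zero hR0 hf h0
  have hre : ∀ z ∈ Metric.ball (0 : ℂ) R, Real.log ‖f z‖ = (g z).re := by
    intro z hz
    rw [← hgf z hz, Complex.norm_exp, Real.log_exp]
  have hzb : z ∈ Metric.ball (0 : ℂ) R := by simpa using hz.trans_lt hR
  have h0b : (0 : ℂ) ∈ Metric.ball (0 : ℂ) R := Metric.mem_ball_self hR0
  have hg0 : -M ≤ (g 0).re := by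
    rw [← hre 0 h0b, Real.le_log_iff_exp_le (norm_pos_iff.2 (h0 0 h0b))]
    exact hfM
  have hle : ∀ z ∈ Metric.ball (0 : ℂ) R, (g z).re ≤ 0 := by
    intro z hz
    rw [← hre z hz]
    exact Real.log_nonpos (norm_nonneg _) (h1 z hz)
  -- `Re g ≤ 0` and `Re g(0) ≥ -M` give `Re (g - g(0)) ≤ M`, the one-sided bound that
  -- Borel–Carathéodory needs.
  have hbc := Complex.borelCaratheodory_zero (f := fun z => g z - g 0) hM
    (hg.sub_const _) (fun w hw => by
      have := hle w hw
      simp only [Set.mem_ofPred_eq, Complex.sub_re]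
      linarith) hR0 hzb (by simp)
  rw [hre z hzb, abs_of_nonpos (hle z hzb)]
  have h3 : -(g z - g 0).re ≤ ‖g z - g 0‖ :=
    (neg_le_abs _).trans (Complex.abs_re_le_norm _)
  have h4 : 2 * M * ‖z‖ / (R - ‖z‖) ≤ 2 * M * r / (R - r) := by
    have : 0 < R - r := by linarith
    gcongr
  rw [Complex.sub_re] at h3
  calc -(g z).re ≤ M + 2 * M * r / (R - r) := by linarith
    _ = _ := by ring

/-- The identity behind the Blaschke factors. -/
theorem norm_sq_sub_conj_mul_sub_sq (R : ℝ) (ρ z : ℂ) :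
    ‖(R : ℂ) ^ 2 - (starRingEnd ℂ) ρ * z‖ ^ 2 - R ^ 2 * ‖z - ρ‖ ^ 2 =
      (R ^ 2 - ‖z‖ ^ 2) * (R ^ 2 - ‖ρ‖ ^ 2) := by
  simp only [Complex.sq_norm, Complex.normSq_apply]
  simp [pow_two]
  ring

/-- Division of a bounded holomorphic function by the Blaschke factor of one of its zeros. -/
theorem exists_eq_blaschke_mul {f : ℂ → ℂ} {U : Set ℂ} {R R' : ℝ} {ρ : ℂ} (hR' : 0 < R')
    (hR : R' < R) (hU : IsOpen U) (hUR : Metric.closedBall 0 R ⊆ U) (hf : DifferentiableOn ℂ f U)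
    (h1 : ∀ z ∈ Metric.closedBall (0 : ℂ) R, ‖f z‖ ≤ 1) (hρ : ‖ρ‖ < R') (hfρ : f ρ = 0) :
    ∃ f₁ : ℂ → ℂ, DifferentiableOn ℂ f₁ U ∧ (∀ z ∈ Metric.closedBall (0 : ℂ) R, ‖f₁ z‖ ≤ 1) ∧
      ‖f 0‖ * (R / R') ≤ ‖f₁ 0‖ ∧
      ∀ z, f z * ((R : ℂ) ^ 2 - (starRingEnd ℂ) ρ * z) = f₁ z * (R * (z - ρ)) := by
  have hR0 : 0 < R := hR'.trans hR
  have hRc : (R : ℂ) ≠ 0 := by exact_mod_cast hR0.ne'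
  have hρU : U ∈ 𝓝 ρ := hU.mem_nhds (hUR (by simpa using (hρ.trans hR).le))
  have hds : ∀ z, f z = dslope f ρ z * (z - ρ) := by
    intro z
    have := sub_smul_dslope f ρ z
    rw [hfρ, sub_zero, smul_eq_mul] at this
    rw [← this, mul_comm]
  have hd : DifferentiableOn ℂ
      (fun z => dslope f ρ z * ((R : ℂ) ^ 2 - (starRingEnd ℂ) ρ * z) / R) U := by
    have := (Complex.differentiableOn_dslope hρU).2 hf
    fun_prop
  have hid : ∀ z, f z * ((R : ℂ) ^ 2 - (starRingEnd ℂ) ρ * z) =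
      (dslope f ρ z * ((R : ℂ) ^ 2 - (starRingEnd ℂ) ρ * z) / R) * (R * (z - ρ)) := by
    intro z
    rw [hds z]
    field_simp
  refine ⟨_, hd, ?_, ?_, hid⟩
  · intro z hz
    -- The Blaschke factor has modulus one on `|w| = R`, so `|f₁| = |f| ≤ 1` there, and the maximum
    -- principle carries the bound inside.
    have hcl : closure (Metric.ball (0 : ℂ) R) = Metric.closedBall 0 R := closure_ball _ hR0.ne'
    refine Complex.norm_le_of_forall_mem_frontier_norm_le (Metric.isBounded_ball (x := (0 : ℂ))
      (r := R)) ⟨hd.mono (Metric.ball_subset_closedBall.trans hUR), ?_⟩ ?_ (by rwa [hcl])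
    · rw [hcl]
      exact hd.continuousOn.mono hUR
    · intro w hw
      rw [frontier_ball _ hR0.ne', mem_sphere_zero_iff_norm] at hw
      have hne : 0 < ‖w - ρ‖ := by
        rw [norm_pos_iff, sub_ne_zero]
        rintro rfl
        linarith
      have e := norm_sq_sub_conj_mul_sub_sq R ρ w
      rw [hw, sub_self, zero_mul, ← mul_pow, sub_eq_zero,
        sq_eq_sq₀ (norm_nonneg _) (by positivity)] at e
      have e2 := congrArg norm (hid w)
      rw [norm_mul, norm_mul (_ / _), norm_mul (R : ℂ), e, Complex.norm_real, Real.norm_eq_abs,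
        abs_of_pos hR0] at e2
      rw [← mul_right_cancel₀ (by positivity) e2]
      exact h1 w (by simp [hw])
  -- The Blaschke factor has modulus `|ρ|/R < R'/R` at `0`. Nothing is divided by `ρ`, so `ρ = 0` is
  -- allowed.
  · have e : ‖f 0‖ = ‖dslope f ρ 0‖ * ‖ρ‖ := by
      have := congrArg norm (hds 0)
      rwa [zero_sub, norm_mul, norm_neg] at this
    have e2 : ‖dslope f ρ 0 * ((R : ℂ) ^ 2 - (starRingEnd ℂ) ρ * 0) / R‖ = ‖dslope f ρ 0‖ * R := by
      rw [norm_div, norm_mul, mul_zero, sub_zero, norm_pow, Complex.norm_real, Real.norm_eq_abs,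
        abs_of_pos hR0]
      field_simp
    simp only [e2, e]
    calc ‖dslope f ρ 0‖ * ‖ρ‖ * (R / R') ≤ ‖dslope f ρ 0‖ * R' * (R / R') := by gcongr
      _ = _ := by field_simp

/-- The Blaschke factor `R(z - ρ)/(R² - ρ̄z)` has modulus at most `1` and at least `|Im z - Im
ρ|/(2R)`. Keeping only imaginary parts makes the cost of a zero a function of the height alone. The
`1 +` makes the cost visibly nonnegative, which settles `w₁ = 0`, where `Real.log 0 = 0`. -/
theorem abs_log_norm_le_of_blaschke {w w₁ z ρ : ℂ} {R : ℝ} (hR : 0 < R) (hz : ‖z‖ ≤ R)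
    (hρ : ‖ρ‖ < R) (hw : w * ((R : ℂ) ^ 2 - (starRingEnd ℂ) ρ * z) = w₁ * (R * (z - ρ)))
    (him : z.im ≠ ρ.im) :
    |Real.log ‖w‖| ≤ |Real.log ‖w₁‖| + Real.log (1 + 2 * R / |z.im - ρ.im|) := by
  have hi : 0 < |z.im - ρ.im| := abs_pos.2 (sub_ne_zero.2 him)
  have hzρ : |z.im - ρ.im| ≤ ‖z - ρ‖ := by
    rw [← Complex.sub_im]; exact Complex.abs_im_le_norm _
  have hp : 0 < ‖z - ρ‖ := hi.trans_le hzρ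
  have hle : R * ‖z - ρ‖ ≤ ‖(R : ℂ) ^ 2 - (starRingEnd ℂ) ρ * z‖ := by
    have e := norm_sq_sub_conj_mul_sub_sq R ρ z
    have h1 : 0 ≤ R ^ 2 - ‖z‖ ^ 2 := sub_nonneg.2 (pow_le_pow_left₀ (norm_nonneg _) hz 2)
    have h2 : 0 ≤ R ^ 2 - ‖ρ‖ ^ 2 := sub_nonneg.2 (pow_le_pow_left₀ (norm_nonneg _) hρ.le 2)
    refine le_of_sq_le_sq ?_ (norm_nonneg _)
    rw [mul_pow]
    nlinarith [mul_nonneg h1 h2]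
  have hge : ‖(R : ℂ) ^ 2 - (starRingEnd ℂ) ρ * z‖ ≤ R * (2 * R) := by
    refine (norm_sub_le _ _).trans ?_
    rw [norm_pow, norm_mul, RCLike.norm_conj, Complex.norm_real, Real.norm_eq_abs, abs_of_pos hR]
    nlinarith [mul_le_mul hρ.le hz (norm_nonneg _) hR.le]
  set P := ‖(R : ℂ) ^ 2 - (starRingEnd ℂ) ρ * z‖ with hP
  have hP0 : 0 < P := (by positivity : 0 < R * ‖z - ρ‖).trans_le hle
  have hpos : 0 ≤ Real.log (1 + 2 * R / |z.im - ρ.im|) := by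
    apply Real.log_nonneg
    have : 0 ≤ 2 * R / |z.im - ρ.im| := by positivity
    linarith
  have e : ‖w‖ = ‖w₁‖ * (R * ‖z - ρ‖ / P) := by
    have e2 := congrArg norm hw
    rw [norm_mul, norm_mul w₁, norm_mul (R : ℂ), Complex.norm_real, Real.norm_eq_abs,
      abs_of_pos hR, ← hP] at e2
    rw [← mul_div_assoc, ← e2]
    field_simp
  rcases eq_or_ne ‖w₁‖ 0 with h0 | h0
  · rw [e, h0]; simpa using hpos
  · rw [e, Real.log_mul h0 (by positivity)]
    refine (abs_add_le _ _).trans ?_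
    gcongr
    rw [abs_of_nonpos (Real.log_nonpos (by positivity) ((div_le_one hP0).2 hle)),
      ← Real.log_inv, inv_div]
    gcongr
    calc P / (R * ‖z - ρ‖) ≤ R * (2 * R) / (R * |z.im - ρ.im|) := by gcongr
      _ = 2 * R / |z.im - ρ.im| := by field_simp
      _ ≤ _ := by linarith

open MeasureTheory

theorem integrableOn_abs_rpow_neg_half :
    IntegrableOn (fun u : ℝ => |u| ^ (-(1 / 2) : ℝ)) (Set.Icc (-1) 1) := by
  have h1 : IntervalIntegrable (fun u : ℝ => |u| ^ (-(1 / 2) : ℝ)) volume 0 1 := by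
    refine (intervalIntegral.intervalIntegrable_rpow' (r := -(1 / 2)) (by norm_num)).congr ?_
    intro x hx
    rw [Set.uIoc_of_le zero_le_one] at hx
    simp only [abs_of_pos hx.1]
  have h2 : IntervalIntegrable (fun u : ℝ => |u| ^ (-(1 / 2) : ℝ)) volume (-1) 0 := by
    have := ((IntervalIntegrable.iff_comp_neg).1 h1).symm
    simpa using this
  have := h2.trans h1
  rwa [intervalIntegrable_iff_integrableOn_Icc_of_le (by norm_num)] at this

/-- The local `L²` norm of `t ↦ log (1 + C / |t - b|)` is bounded uniformly in `b`. -/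
theorem exists_eLpNorm_log_one_add_div_le {C : ℝ} (hC : 0 ≤ C) :
    ∃ K : ℝ, 0 ≤ K ∧ ∀ a b : ℝ, eLpNorm (fun t : ℝ => Real.log (1 + C / |t - b|)) 2
      (volume.restrict (Set.Icc a (a + 1))) ≤ ENNReal.ofReal K := by
  set φ : ℝ → ℝ := fun u => Real.log (1 + C / |u|) with hφ
  have hφm : Measurable φ := by fun_prop
  have hφ0 : ∀ u, 0 ≤ φ u := by
    intro u
    apply Real.log_nonneg
    have : 0 ≤ C / |u| := by positivity
    linarith
  have hmem : MemLp ((Set.Icc (-1 : ℝ) 1).indicator φ) 2 := by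
    rw [memLp_indicator_iff_restrict measurableSet_Icc,
      memLp_two_iff_integrable_sq hφm.aestronglyMeasurable]
    refine (integrableOn_abs_rpow_neg_half.const_mul (16 * (1 + C) ^ (1 / 2 : ℝ))).mono'
      (by fun_prop) ?_
    filter_upwards [ae_restrict_mem measurableSet_Icc] with u hu
    rw [Real.norm_eq_abs, abs_of_nonneg (sq_nonneg _)]
    rcases eq_or_ne u 0 with rfl | h0
    · simp only [hφ, abs_zero, div_zero, add_zero, Real.log_one, zero_pow two_ne_zero]
      positivity
    · have hu0 : 0 < |u| := abs_pos.2 h0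
      have hu1 : |u| ≤ 1 := abs_le.2 hu
      have hx : 0 ≤ 1 + C / |u| := by positivity
      -- `log y ≤ 4 y^{1/4}`, so the squared logarithm is at most `16 y^{1/2}`, an integrable
      -- singularity.
      have h1 := Real.log_le_rpow_div hx (ε := 1 / 4) (by norm_num)
      have h2 : 1 + C / |u| ≤ (1 + C) / |u| := by
        rw [add_div]; gcongr; rwa [le_div_iff₀ hu0, one_mul]
      calc φ u ^ 2 ≤ ((1 + C / |u|) ^ (1 / 4 : ℝ) / (1 / 4)) ^ 2 := by
            gcongr
            exact hφ0 u
        _ = 16 * (1 + C / |u|) ^ (1 / 2 : ℝ) := by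
            rw [div_pow, ← Real.rpow_natCast, ← Real.rpow_mul hx]
            norm_num
            ring
        _ ≤ 16 * ((1 + C) / |u|) ^ (1 / 2 : ℝ) := by gcongr
        _ = _ := by
            rw [Real.div_rpow (by positivity) hu0.le, Real.rpow_neg hu0.le]
            ring
  refine ⟨(eLpNorm ((Set.Icc (-1 : ℝ) 1).indicator φ) 2 volume).toReal + Real.log (1 + C),
    by have := Real.log_nonneg (by linarith : 1 ≤ 1 + C); positivity, fun a b => ?_⟩
  rw [ENNReal.ofReal_add ENNReal.toReal_nonneg (Real.log_nonneg (by linarith)),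
    ENNReal.ofReal_toReal hmem.eLpNorm_ne_top]
  -- Beyond distance `1` from `b` the function is at most `log (1 + C)`; the part within is a
  -- translate of one fixed function, which gives uniformity in `b`.
  have hpt : ∀ t, ‖φ (t - b)‖ ≤
      ‖((Set.Icc (-1 : ℝ) 1).indicator φ ∘ (fun t => t - b)) t + Real.log (1 + C)‖ := by
    intro t
    have hl : 0 ≤ Real.log (1 + C) := Real.log_nonneg (by linarith)
    have hi : 0 ≤ (Set.Icc (-1 : ℝ) 1).indicator φ (t - b) :=
      Set.indicator_nonneg (fun _ _ => hφ0 _) _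
    simp only [Function.comp_apply, Real.norm_eq_abs]
    rw [abs_of_nonneg (hφ0 _), abs_of_nonneg (by positivity)]
    by_cases ht : t - b ∈ Set.Icc (-1 : ℝ) 1
    · rw [Set.indicator_of_mem ht]; linarith
    · rw [Set.indicator_of_notMem ht, zero_add]
      have : 1 ≤ |t - b| := by
        rw [Set.mem_Icc, ← abs_le] at ht
        linarith
      simp only [hφ]
      gcongr
      exact div_le_self hC this
  refine (eLpNorm_mono hpt).trans ((eLpNorm_add_le ?_ ?_ (by norm_num)).trans ?_)
  · exact ((hφm.indicator measurableSet_Icc).comp (by fun_prop)).aestronglyMeasurable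
  · exact aestronglyMeasurable_const
  · gcongr
    · refine (eLpNorm_mono_measure _ Measure.restrict_le_self).trans (le_of_eq ?_)
      exact eLpNorm_comp_measurePreserving hmem.1 (measurePreserving_sub_right volume b)
    · rw [eLpNorm_const _ (by norm_num) (by simp)]
      simp [Real.volume_Icc, Real.enorm_eq_ofReal (Real.log_nonneg (by linarith : 1 ≤ 1 + C))]

/-- The `L²` norm of `log |f|` on a vertical unit segment inside a disc is controlled by
`log (1 / |f 0|)` for a holomorphic function `f` bounded by `1` on a larger disc. -/
theorem exists_eLpNorm_log_norm_le {r R' R : ℝ} (hr : 0 ≤ r) (hrR' : r < R') (hR : R' < R) :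
    ∃ A : ℝ, 0 ≤ A ∧ ∀ (k : ℕ) (f : ℂ → ℂ) (U : Set ℂ), IsOpen U → Metric.closedBall 0 R ⊆ U →
      DifferentiableOn ℂ f U → (∀ z ∈ Metric.closedBall (0 : ℂ) R, ‖f z‖ ≤ 1) →
      (R' / R) ^ k ≤ ‖f 0‖ → ∀ x : ℝ,
      (∀ t ∈ Set.Icc (0 : ℝ) 1, ‖(x : ℂ) + t * Complex.I‖ ≤ r) →
      eLpNorm (fun t : ℝ => Real.log ‖f (x + t * Complex.I)‖) 2
        (volume.restrict (Set.Icc 0 1)) ≤ ENNReal.ofReal (A * (k + 1)) := by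
  have hR'0 : 0 < R' := hr.trans_lt hrR'
  have hR0 : 0 < R := hR'0.trans hR
  obtain ⟨K, hK0, hK⟩ := exists_eLpNorm_log_one_add_div_le (C := 2 * R) (by positivity)
  have hq : 0 < Real.log (R / R') := Real.log_pos ((one_lt_div hR'0).2 hR)
  have hd : 0 < R' - r := sub_pos.2 hrR'
  -- `K` is the cost of one zero; `B` is the Borel–Carathéodory bound when `|f 0|` is at least
  -- `R'/R`.
  set B : ℝ := Real.log (R / R') * (1 + 2 * r / (R' - r)) with hB
  have hB0 : 0 ≤ B := by positivity
  refine ⟨K + B, by positivity, ?_⟩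
  intro k
  -- Dividing out a zero in `|z| < R'` raises `|f 0|` by the factor `R/R'`, hence lowers `k` by one.
  -- At `k = 0` no zero is left, as the quotient would exceed `1` at the centre.
  induction k with
  | zero =>
    intro f U hU hUR hf h1 hf0 x hx
    rw [pow_zero] at hf0
    have hz : ∀ z ∈ Metric.ball (0 : ℂ) R', f z ≠ 0 := by
      intro ρ hρ hfρ
      rw [mem_ball_zero_iff] at hρ
      obtain ⟨f₁, -, hb, hge, -⟩ := exists_eq_blaschke_mul hR'0 hR hU hUR hf h1 hρ hfρ
      have h2 := hb 0 (by simp [hR0.le])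
      have h3 : 1 < R / R' := (one_lt_div hR'0).2 hR
      nlinarith
    have hsub : Metric.ball (0 : ℂ) R' ⊆ Metric.closedBall 0 R :=
      (Metric.ball_subset_ball hR.le).trans Metric.ball_subset_closedBall
    have hpt : ∀ᵐ t : ℝ ∂(volume.restrict (Set.Icc (0 : ℝ) 1)),
        ‖Real.log ‖f (x + t * Complex.I)‖‖ ≤ B := by
      filter_upwards [ae_restrict_mem measurableSet_Icc] with t ht
      exact abs_log_norm_le_of_ne_zero hrR' hq (hf.mono (hsub.trans hUR)) hz
        (fun z hz => h1 z (hsub hz)) ((Real.exp_le_one_iff.2 (by linarith)).trans hf0) (hx t ht)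
    refine (eLpNorm_le_of_ae_bound hpt).trans ?_
    simp only [Measure.restrict_apply_univ, Real.volume_Icc, sub_zero, ENNReal.ofReal_one,
      ENNReal.one_rpow, one_mul]
    apply ENNReal.ofReal_le_ofReal
    push_cast
    linarith
  | succ k ih =>
    intro f U hU hUR hf h1 hf0 x hx
    by_cases hz : ∀ z ∈ Metric.ball (0 : ℂ) R', f z ≠ 0
    · have hsub : Metric.ball (0 : ℂ) R' ⊆ Metric.closedBall 0 R :=
        (Metric.ball_subset_ball hR.le).trans Metric.ball_subset_closedBall
      have hM : Real.exp (-((k + 1 : ℕ) * Real.log (R / R'))) ≤ ‖f 0‖ := by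
        refine le_trans (le_of_eq ?_) hf0
        rw [← mul_neg, ← Real.log_inv, inv_div, Real.exp_nat_mul, Real.exp_log (by positivity)]
      have hpt : ∀ᵐ t : ℝ ∂(volume.restrict (Set.Icc (0 : ℝ) 1)),
          ‖Real.log ‖f (x + t * Complex.I)‖‖ ≤ (k + 1 : ℕ) * B := by
        filter_upwards [ae_restrict_mem measurableSet_Icc] with t ht
        rw [hB, ← mul_assoc]
        exact abs_log_norm_le_of_ne_zero hrR' (by positivity) (hf.mono (hsub.trans hUR)) hz
          (fun z hz => h1 z (hsub hz)) hM (hx t ht)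
      refine (eLpNorm_le_of_ae_bound hpt).trans ?_
      simp only [Measure.restrict_apply_univ, Real.volume_Icc, sub_zero, ENNReal.ofReal_one,
        ENNReal.one_rpow, one_mul]
      apply ENNReal.ofReal_le_ofReal
      push_cast
      have : (0 : ℝ) ≤ k := k.cast_nonneg
      nlinarith [mul_nonneg this hB0, mul_nonneg this hK0]
    · push Not at hz
      obtain ⟨ρ, hρ, hfρ⟩ := hz
      rw [mem_ball_zero_iff] at hρ
      obtain ⟨f₁, hf₁, hb, hge, hid⟩ := exists_eq_blaschke_mul hR'0 hR hU hUR hf h1 hρ hfρ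
      have hge' : (R' / R) ^ k ≤ ‖f₁ 0‖ := by
        refine le_trans (le_of_eq ?_) ((mul_le_mul_of_nonneg_right hf0 (by positivity)).trans hge)
        rw [pow_succ]
        field_simp
      have hi := ih f₁ U hU hUR hf₁ hb hge' x hx
      have hcont : ContinuousOn (fun t : ℝ => f₁ (x + t * Complex.I)) (Set.Icc 0 1) := by
        refine hf₁.continuousOn.comp (by fun_prop) fun t ht => hUR ?_
        rw [mem_closedBall_zero_iff]
        exact (hx t ht).trans (hrR'.trans hR).le
      have hm1 : AEStronglyMeasurable (fun t : ℝ => |Real.log ‖f₁ (x + t * Complex.I)‖|)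
          (volume.restrict (Set.Icc 0 1)) :=
        ((Real.measurable_log.comp_aemeasurable
          (hcont.aestronglyMeasurable measurableSet_Icc).norm.aemeasurable).abs).aestronglyMeasurable
      have hm2 : AEStronglyMeasurable (fun t : ℝ => Real.log (1 + 2 * R / |t - ρ.im|))
          (volume.restrict (Set.Icc (0 : ℝ) 1)) := by
        refine Measurable.aestronglyMeasurable ?_
        fun_prop
      have hne : ∀ᵐ t : ℝ ∂(volume.restrict (Set.Icc (0 : ℝ) 1)), t ≠ ρ.im :=
        ae_restrict_of_ae (Measure.ae_ne volume _)
      refine (eLpNorm_mono_ae (g := (fun t : ℝ => |Real.log ‖f₁ (x + t * Complex.I)‖|) +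
        fun t : ℝ => Real.log (1 + 2 * R / |t - ρ.im|)) ?_).trans
        ((eLpNorm_add_le hm1 hm2 (by norm_num)).trans ?_)
      · filter_upwards [ae_restrict_mem measurableSet_Icc, hne] with t ht htne
        have him : ((x : ℂ) + t * Complex.I).im = t := by simp
        have := abs_log_norm_le_of_blaschke hR0 ((hx t ht).trans (hrR'.trans hR).le)
          (hρ.trans hR) (hid _) (by rwa [him])
        rw [him] at this
        exact this.trans (le_abs_self (_ + _))
      · have e1 : eLpNorm (fun t : ℝ => |Real.log ‖f₁ (x + t * Complex.I)‖|) 2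
            (volume.restrict (Set.Icc 0 1)) = eLpNorm (fun t : ℝ =>
            Real.log ‖f₁ (x + t * Complex.I)‖) 2 (volume.restrict (Set.Icc 0 1)) :=
          eLpNorm_norm (fun t : ℝ => Real.log ‖f₁ (x + t * Complex.I)‖)
        have e2 := hK 0 ρ.im
        rw [zero_add] at e2
        rw [e1]
        refine (add_le_add hi e2).trans ?_
        rw [← ENNReal.ofReal_add (by positivity) hK0]
        apply ENNReal.ofReal_le_ofReal
        push_cast
        linarith

/-! ### Pointwise bounds from area integrals. -/

/-- The mean value inequality for `|f|²` over circles. -/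
theorem two_pi_mul_enorm_sq_le_lintegral_circle {f : ℂ → ℂ} {z : ℂ} {r : ℝ} (hr : 0 < r)
    (hf : DifferentiableOn ℂ f (Metric.closedBall z r)) :
    ENNReal.ofReal (2 * Real.pi) * ‖f z‖ₑ ^ 2 ≤
      ∫⁻ θ in Set.Ioo (-Real.pi) Real.pi, ‖f (circleMap z r θ)‖ₑ ^ 2 := by
  -- Cauchy's mean value property of the holomorphic function `f²` replaces subharmonicity of
  -- `|f|²`.
  have hd : DiffContOnCl ℂ (fun w => f w ^ 2) (Metric.ball z |r|) := by
    rw [abs_of_pos hr]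
    refine ⟨(hf.mono Metric.ball_subset_closedBall).pow 2, ?_⟩
    rw [closure_ball _ hr.ne']
    exact hf.continuousOn.pow 2
  have h1 := hd.circleAverage
  rw [Real.circleAverage_def, inv_smul_eq_iff₀ (by positivity)] at h1
  have hper : Function.Periodic (fun θ => f (circleMap z r θ) ^ 2) (2 * Real.pi) := by
    intro θ
    simp only [periodic_circleMap z r θ]
  have h2 := hper.intervalIntegral_add_eq 0 (-Real.pi)
  rw [zero_add, show -Real.pi + 2 * Real.pi = Real.pi by ring] at h2
  rw [h2, intervalIntegral.integral_of_le (by linarith [Real.pi_pos]), integral_Ioc_eq_integral_Ioo]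
    at h1
  have h3 := congrArg enorm h1
  rw [enorm_smul, enorm_pow, Real.enorm_eq_ofReal (by positivity)] at h3
  rw [← h3]
  refine (enorm_integral_le_lintegral_enorm _).trans (le_of_eq ?_)
  simp only [enorm_pow]

/-- The mean value inequality for `|f|²` over discs. -/
theorem enorm_sq_le_lintegral_closedBall {f : ℂ → ℂ} (hm : Measurable f) {z : ℂ} {δ : ℝ}
    (hδ : 0 < δ) (hf : DifferentiableOn ℂ f (Metric.closedBall z δ)) :
    ENNReal.ofReal (Real.pi * δ ^ 2) * ‖f z‖ₑ ^ 2 ≤ ∫⁻ w in Metric.closedBall z δ, ‖f w‖ₑ ^ 2 := by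
  set F : ℂ → ENNReal := fun w =>
    (Metric.closedBall (0 : ℂ) δ).indicator (fun w => ‖f (z + w)‖ₑ ^ 2) w with hF
  have hFm : Measurable F :=
    Measurable.indicator (by fun_prop) measurableSet_closedBall
  have e1 : ∫⁻ w in Metric.closedBall z δ, ‖f w‖ₑ ^ 2 = ∫⁻ w, F w := by
    rw [← lintegral_indicator measurableSet_closedBall,
      ← lintegral_add_left_eq_self _ z]
    refine lintegral_congr fun w => ?_
    have hiff : z + w ∈ Metric.closedBall z δ ↔ w ∈ Metric.closedBall (0 : ℂ) δ := by simp
    by_cases hw : w ∈ Metric.closedBall (0 : ℂ) δ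
    · simp only [hF, Set.indicator_of_mem hw, Set.indicator_of_mem (hiff.2 hw)]
    · simp only [hF, Set.indicator_of_notMem hw, Set.indicator_of_notMem (mt hiff.1 hw)]
  have hsm : Measurable fun p : ℝ × ℝ => ENNReal.ofReal p.1 • F (Complex.polarCoord.symm p) := by
    refine (ENNReal.measurable_ofReal.comp measurable_fst).smul (hFm.comp ?_)
    have : Measurable fun p : ℝ × ℝ =>
        (p.1 : ℂ) * (Real.cos p.2 + Real.sin p.2 * Complex.I) := by
      fun_prop
    convert! this using 1
    funext p
    exact Complex.polarCoord_symm_apply p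
  rw [e1, ← Complex.lintegral_comp_polarCoord_symm, polarCoord_target, Measure.volume_eq_prod,
    setLIntegral_prod _ hsm.aemeasurable]
  have hin : ∀ r ∈ Set.Ioc 0 δ, ENNReal.ofReal (2 * Real.pi * r) * ‖f z‖ₑ ^ 2 ≤
      ∫⁻ θ in Set.Ioo (-Real.pi) Real.pi,
        ENNReal.ofReal r • F (Complex.polarCoord.symm (r, θ)) := by
    intro r hr
    have := two_pi_mul_enorm_sq_le_lintegral_circle hr.1
      (hf.mono (Metric.closedBall_subset_closedBall hr.2))
    have e2 : ∀ θ, F (Complex.polarCoord.symm (r, θ)) = ‖f (circleMap z r θ)‖ₑ ^ 2 := by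
      intro θ
      have hmem : Complex.polarCoord.symm (r, θ) ∈ Metric.closedBall (0 : ℂ) δ := by
        rw [mem_closedBall_zero_iff, Complex.norm_polarCoord_symm, abs_of_pos hr.1]
        exact hr.2
      simp only [hF, Set.indicator_of_mem hmem]
      rw [Complex.polarCoord_symm_apply, circleMap, Complex.exp_mul_I, Complex.ofReal_cos,
        Complex.ofReal_sin]
    simp only [e2, smul_eq_mul]
    rw [lintegral_const_mul' _ _ ENNReal.ofReal_ne_top, mul_comm (2 * Real.pi),
      ENNReal.ofReal_mul hr.1.le, mul_assoc]
    gcongr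
  calc ENNReal.ofReal (Real.pi * δ ^ 2) * ‖f z‖ₑ ^ 2
      = ∫⁻ r in Set.Ioc 0 δ, ENNReal.ofReal (2 * Real.pi * r) * ‖f z‖ₑ ^ 2 := by
        rw [lintegral_mul_const _ (by fun_prop), ← ofReal_integral_eq_lintegral_ofReal]
        · rw [← intervalIntegral.integral_of_le hδ.le, intervalIntegral.integral_const_mul,
            integral_id]
          congr 2
          ring
        · exact ((continuous_const.mul continuous_id).integrableOn_Icc).mono_set
            Set.Ioc_subset_Icc_self
        · filter_upwards [ae_restrict_mem measurableSet_Ioc] with r hr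
          have := hr.1
          simp only [Pi.zero_apply]
          positivity
    _ ≤ ∫⁻ r in Set.Ioc 0 δ, ∫⁻ θ in Set.Ioo (-Real.pi) Real.pi,
        ENNReal.ofReal r • F (Complex.polarCoord.symm (r, θ)) :=
        setLIntegral_mono' measurableSet_Ioc hin
    _ ≤ _ := lintegral_mono_set Set.Ioc_subset_Ioi_self

/-- The value of `|f|²` is controlled by its integral over a surrounding rectangle. -/
theorem enorm_sq_le_lintegral_rectangle {f : ℂ → ℂ} (hm : Measurable f) {z : ℂ}
    {δ a b c d : ℝ} (hδ : 0 < δ) (hf : DifferentiableOn ℂ f (Metric.closedBall z δ))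
    (ha : a ≤ z.re - δ) (hb : z.re + δ ≤ b) (hc : c ≤ z.im - δ) (hd : z.im + δ ≤ d) :
    ENNReal.ofReal (Real.pi * δ ^ 2) * ‖f z‖ₑ ^ 2 ≤
      ∫⁻ σ in Set.Icc a b, ∫⁻ t in Set.Icc c d, ‖f ((σ : ℂ) + (t : ℂ) * Complex.I)‖ₑ ^ 2 := by
  refine (enorm_sq_le_lintegral_closedBall hm hδ hf).trans ?_
  have hsub : Metric.closedBall z δ ⊆
      Complex.measurableEquivRealProd ⁻¹' (Set.Icc a b ×ˢ Set.Icc c d) := by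
    intro w hw
    rw [mem_closedBall_iff_norm] at hw
    have h1 := abs_le.1 ((Complex.abs_re_le_norm _).trans hw)
    have h2 := abs_le.1 ((Complex.abs_im_le_norm _).trans hw)
    rw [Complex.sub_re] at h1
    rw [Complex.sub_im] at h2
    simp only [Set.mem_preimage, Complex.measurableEquivRealProd_apply, Set.mem_prod, Set.mem_Icc]
    exact ⟨⟨by linarith, by linarith⟩, by linarith, by linarith⟩
  refine (lintegral_mono_set hsub).trans (le_of_eq ?_)
  have hgm : Measurable fun p : ℝ × ℝ => ‖f ((p.1 : ℂ) + (p.2 : ℂ) * Complex.I)‖ₑ ^ 2 := by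
    fun_prop
  have := Complex.volume_preserving_equiv_real_prod.setLIntegral_comp_preimage
    (measurableSet_Icc.prod measurableSet_Icc : MeasurableSet (Set.Icc a b ×ˢ Set.Icc c d)) hgm
  rw [Measure.volume_eq_prod, setLIntegral_prod _ hgm.aemeasurable] at this
  rw [← this]
  simp [Complex.measurableEquivRealProd_apply, Complex.re_add_im]

/-! ### From a mean square bound for `G` to one for `log |G|`. -/

theorem lintegral_enorm_sq_le_of_eLpNorm_le {α : Type*} [MeasurableSpace α] {μ : Measure α}
    {f : α → ℝ} {B : ENNReal} (h : eLpNorm f 2 μ ≤ B) : ∫⁻ x, ‖f x‖ₑ ^ 2 ∂μ ≤ B ^ 2 := by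
  have := eLpNorm_nnreal_pow_eq_lintegral (f := f) (μ := μ) (p := 2) (by norm_num)
  have e : ∫⁻ x, ‖f x‖ₑ ^ 2 ∂μ = eLpNorm f 2 μ ^ 2 := by
    norm_num at this
    exact this.symm
  rw [e]
  gcongr

theorem lintegral_Icc_zero_natCast_le_sum (h : ℝ → ENNReal) (N : ℕ) :
    ∫⁻ t in Set.Icc 0 (N : ℝ), h t ≤
      ∑ n ∈ Finset.range N, ∫⁻ t in Set.Icc (n : ℝ) (n + 1), h t := by
  induction N with
  | zero => simp
  | succ N ih =>
    rw [Finset.sum_range_succ]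
    have : Set.Icc (0 : ℝ) ((N + 1 : ℕ) : ℝ) = Set.Icc 0 (N : ℝ) ∪ Set.Icc (N : ℝ) (N + 1) := by
      rw [Set.Icc_union_Icc_eq_Icc (by positivity) (by linarith)]
      push_cast
      rfl
    rw [this]
    refine (lintegral_union_le _ _ _).trans ?_
    gcongr

theorem setLIntegral_Icc_add_one_eq (h : ℝ → ENNReal) (a : ℝ) :
    ∫⁻ t in Set.Icc a (a + 1), h t = ∫⁻ t in Set.Icc (0 : ℝ) 1, h (a + t) := by
  rw [← lintegral_indicator measurableSet_Icc, ← lintegral_indicator measurableSet_Icc,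
    ← lintegral_add_left_eq_self _ a]
  refine lintegral_congr fun t => ?_
  have hiff : a + t ∈ Set.Icc a (a + 1) ↔ t ∈ Set.Icc (0 : ℝ) 1 := by simp [Set.mem_Icc]
  by_cases ht : t ∈ Set.Icc (0 : ℝ) 1
  · rw [Set.indicator_of_mem ht, Set.indicator_of_mem (hiff.2 ht)]
  · rw [Set.indicator_of_notMem ht, Set.indicator_of_notMem (mt hiff.1 ht)]

/-- Integrals over windows of length `2K` around `0, …, N - 1` overlap at most `2K + 1` times. -/
theorem sum_lintegral_window_le {g : ℝ → ENNReal} (hg : Measurable g) (N K : ℕ) :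
    ∑ n ∈ Finset.range N, ∫⁻ t in Set.Icc ((n : ℝ) - K) (n + K), g t ≤
      ((2 * K + 1 : ℕ) : ENNReal) * ∫⁻ t in Set.Icc (-(N + K : ℝ)) (N + K), g t := by
  simp only [← lintegral_indicator (measurableSet_Icc)]
  rw [← lintegral_finsetSum _ (fun n _ => hg.indicator measurableSet_Icc),
    ← lintegral_const_mul _ (hg.indicator measurableSet_Icc)]
  refine lintegral_mono fun t => ?_
  have hcard : ((Finset.range N).filter (fun n : ℕ => t ∈ Set.Icc ((n : ℝ) - K) (n + K))).card ≤
      2 * K + 1 := by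
    have hinj := Finset.card_le_card_of_injOn
      (s := (Finset.range N).filter (fun n : ℕ => t ∈ Set.Icc ((n : ℝ) - K) (n + K)))
      (t := Finset.Icc ⌈t - K⌉ ⌊t + K⌋) (fun n : ℕ => (n : ℤ)) ?_ ?_
    · refine hinj.trans ?_
      rw [Int.card_Icc]
      have h1 : ((⌊t + K⌋ : ℤ) : ℝ) ≤ t + K := Int.floor_le _
      have h2 : t - K ≤ ((⌈t - K⌉ : ℤ) : ℝ) := Int.le_ceil _
      have h3 : ((⌊t + K⌋ - ⌈t - K⌉ : ℤ) : ℝ) ≤ ((2 * K : ℤ) : ℝ) := by push_cast; linarith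
      have h4 : ⌊t + K⌋ - ⌈t - K⌉ ≤ 2 * K := by exact_mod_cast h3
      omega
    · intro n hn
      simp only [Finset.coe_filter, Set.mem_ofPred_eq, Set.mem_Icc] at hn
      simp only [Finset.coe_Icc, Set.mem_Icc, Int.ceil_le, Int.le_floor, Int.cast_natCast]
      exact ⟨by linarith [hn.2.2], by linarith [hn.2.1]⟩
    · intro m _ n _ h
      simpa using h
  simp only [Set.indicator_apply]
  rw [Finset.sum_ite, Finset.sum_const_zero, add_zero, Finset.sum_const, nsmul_eq_mul]
  split_ifs with h
  · gcongr
  · rw [Finset.card_eq_zero.2]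
    · simp
    · rw [Finset.filter_eq_empty_iff]
      intro n hn hmem
      apply h
      have hn' : (n : ℝ) ≤ N := by exact_mod_cast (Finset.mem_range.1 hn).le
      have hn0 : (0 : ℝ) ≤ n := n.cast_nonneg
      have hN0 : (0 : ℝ) ≤ N := N.cast_nonneg
      exact ⟨by linarith [hmem.1], by linarith [hmem.2]⟩

/-- The local `L²` norm of `log |G|` on a vertical segment is controlled by an upper bound for `|G|`
on a disc, provided that `|G|` is bounded from below at the centre. -/
theorem exists_lintegral_log_sq_le_sq {r R' R c : ℝ} (hr : 0 ≤ r) (hrR' : r < R') (hR : R' < R)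
    (hc : 0 < c) :
    ∃ D : ℝ, 0 ≤ D ∧ ∀ (G : ℂ → ℂ) (U : Set ℂ) (w : ℂ) (M : ℝ), Measurable G → IsOpen U →
      Metric.closedBall w R ⊆ U → DifferentiableOn ℂ G U → 1 ≤ M →
      (∀ z ∈ Metric.closedBall w R, ‖G z‖ ≤ M) → c ≤ ‖G w‖ → ∀ x : ℝ,
      (∀ t ∈ Set.Icc (0 : ℝ) 1, ‖(x : ℂ) + t * Complex.I‖ ≤ r) →
      ∫⁻ t in Set.Icc (0 : ℝ) 1, ‖Real.log ‖G (w + (x + t * Complex.I))‖‖ₑ ^ 2 ≤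
        ENNReal.ofReal (D * M) ^ 2 := by
  obtain ⟨A, hA0, hA⟩ := exists_eLpNorm_log_norm_le hr hrR' hR
  have hR'0 : 0 < R' := hr.trans_lt hrR'
  have hR0 : 0 < R := hR'0.trans hR
  set q := Real.log (R / R') with hq
  have hq0 : 0 < q := Real.log_pos ((one_lt_div hR'0).2 hR)
  refine ⟨A * (1 / (c * q) + 2) + 1, by positivity, ?_⟩
  intro G U w M hm hU hUR hG hM hGM hGc x hx
  have hM0 : 0 < M := by linarith
  apply lintegral_enorm_sq_le_of_eLpNorm_le
  set f : ℂ → ℂ := fun z => G (w + z) / M with hf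
  set V : Set ℂ := (fun z => w + z) ⁻¹' U with hV
  have hVo : IsOpen V := hU.preimage (by fun_prop)
  have hball : ∀ z ∈ Metric.closedBall (0 : ℂ) R, w + z ∈ Metric.closedBall w R := by
    intro z hz
    simpa using hz
  have hVR : Metric.closedBall 0 R ⊆ V := fun z hz => hUR (hball z hz)
  have hfd : DifferentiableOn ℂ f V :=
    (hG.comp (by fun_prop) (Set.mapsTo_preimage _ _)).div_const _
  have hfn : ∀ z, ‖f z‖ = ‖G (w + z)‖ / M := by
    intro z
    rw [hf, norm_div, Complex.norm_real, Real.norm_eq_abs, abs_of_pos hM0]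
  have hf1 : ∀ z ∈ Metric.closedBall (0 : ℂ) R, ‖f z‖ ≤ 1 := by
    intro z hz
    rw [hfn, div_le_one hM0]
    exact hGM _ (hball z hz)
  -- The least `k` with `(R'/R)^k ≤ c/M`, the lower bound for the normalised central value.
  set k := ⌈Real.log (M / c) / q⌉₊ with hk
  have hk1 : (R' / R) ^ k ≤ ‖f 0‖ := by
    rw [hfn, add_zero]
    refine le_trans ?_ (div_le_div_of_nonneg_right hGc hM0.le)
    have h1 : Real.log (M / c) ≤ k * q := by
      rw [← div_le_iff₀ hq0]
      exact Nat.le_ceil _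
    rw [← Real.log_le_log_iff (by positivity) (by positivity), Real.log_pow, ← inv_div R R',
      Real.log_inv, ← inv_div M c, Real.log_inv, ← hq]
    linarith
  have h2 := hA k f V hVo hVR hfd hf1 hk1 x hx
  -- The bound obtained is logarithmic in `M`. It is weakened to a linear one because its square is
  -- then controlled by the mean square of `G`.
  have hlogM : Real.log M ≤ M := Real.log_le_self hM0.le
  have hlogM0 : 0 ≤ Real.log M := Real.log_nonneg hM
  have hk2 : (k : ℝ) + 1 ≤ (1 / (c * q) + 2) * M := by
    have h3 : Real.log (M / c) / q ≤ M / c / q := by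
      gcongr
      exact Real.log_le_self (by positivity)
    have h4 : (k : ℝ) ≤ M / c / q + 1 := by
      have h5 : k ≤ ⌈M / c / q⌉₊ := Nat.ceil_mono h3
      have h6 := (Nat.ceil_lt_add_one (by positivity : 0 ≤ M / c / q)).le
      exact le_trans (by exact_mod_cast h5) h6
    calc (k : ℝ) + 1 ≤ M / c / q + 2 := by linarith
      _ ≤ M / c / q + 2 * M := by linarith
      _ = _ := by field_simp
  have hpt : ∀ t : ℝ, ‖Real.log ‖G (w + (x + t * Complex.I))‖‖ ≤
      ‖((fun t : ℝ => |Real.log ‖f (x + t * Complex.I)‖| : ℝ → ℝ) +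
        (fun _ => Real.log M : ℝ → ℝ)) t‖ := by
    intro t
    refine le_trans ?_ (Real.le_norm_self _)
    simp only [Pi.add_apply, hfn]
    rcases eq_or_ne ‖G (w + (x + t * Complex.I))‖ 0 with h | h
    · simp [h, hlogM0]
    · rw [Real.log_div h hM0.ne', Real.norm_eq_abs]
      have := abs_add_le (Real.log ‖G (w + (x + t * Complex.I))‖ - Real.log M) (Real.log M)
      rw [sub_add_cancel, abs_of_nonneg hlogM0] at this
      exact this
  have hm1 : AEStronglyMeasurable (fun t : ℝ => |Real.log ‖f (x + t * Complex.I)‖|)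
      (volume.restrict (Set.Icc (0 : ℝ) 1)) := by
    refine Measurable.aestronglyMeasurable ?_
    simp only [hfn]
    fun_prop
  refine (eLpNorm_mono hpt).trans
    ((eLpNorm_add_le hm1 aestronglyMeasurable_const (by norm_num)).trans ?_)
  have e1 : eLpNorm (fun t : ℝ => |Real.log ‖f (x + t * Complex.I)‖|) 2
      (volume.restrict (Set.Icc 0 1)) = eLpNorm (fun t : ℝ =>
      Real.log ‖f (x + t * Complex.I)‖) 2 (volume.restrict (Set.Icc 0 1)) :=
    eLpNorm_norm (fun t : ℝ => Real.log ‖f (x + t * Complex.I)‖)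
  have e2 : eLpNorm (fun _ : ℝ => Real.log M) 2 (volume.restrict (Set.Icc (0 : ℝ) 1)) =
      ENNReal.ofReal (Real.log M) := by
    rw [eLpNorm_const _ (by norm_num) (by simp)]
    simp [Real.volume_Icc, Real.enorm_eq_ofReal hlogM0]
  rw [e1, e2]
  refine (add_le_add_left h2 _).trans ?_
  rw [← ENNReal.ofReal_add (by positivity) hlogM0]
  apply ENNReal.ofReal_le_ofReal
  nlinarith [mul_le_mul_of_nonneg_left hk2 hA0]

/-- A large circle is flat: `r² - (r - ε/2)² = rε - ε²/4 ≥ 7/4`, which leaves room for a segment of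
height one. -/
theorem norm_add_mul_I_le_of_sub_half_le {r ε x t : ℝ} (hε : 0 < ε) (hε1 : ε ≤ 1)
    (h : 2 ≤ r * ε) (hx : |x| ≤ r - ε / 2) (ht : t ∈ Set.Icc (0 : ℝ) 1) :
    ‖(x : ℂ) + t * Complex.I‖ ≤ r := by
  have hr : 0 ≤ r := by linarith [abs_nonneg x]
  rw [Complex.norm_add_mul_I, Real.sqrt_le_left hr]
  have h3 : x ^ 2 ≤ (r - ε / 2) ^ 2 := by
    rw [← sq_abs]
    gcongr
  have h4 : t ^ 2 ≤ 1 := pow_le_one₀ ht.1 ht.2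
  have h5 : ε ^ 2 ≤ 1 := pow_le_one₀ hε.le hε1
  linarith [show (r - ε / 2) ^ 2 = r ^ 2 - r * ε + ε ^ 2 / 4 by ring]

/-- A mean square bound for `G` in `Re s > 1/2` and a lower bound for `|G|` in `Re s ≥ 2` imply
a mean square bound for `log |G|` in `Re s > 1/2`. -/
theorem exists_lintegral_log_sq_le {G : ℂ → ℂ} (hm : Measurable G)
    (hd : DifferentiableOn ℂ G {s | 0 < s.re}) {c : ℝ} (hc : 0 < c)
    (hlow : ∀ s : ℂ, 2 ≤ s.re → c ≤ ‖G s‖)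
    (hms : ∀ δ b : ℝ, 0 < δ → ∃ C : ℝ, 0 ≤ C ∧ ∀ T : ℝ, 1 ≤ T → ∀ σ ∈ Set.Icc (1 / 2 + δ) b,
      ∫⁻ t in Set.Icc (-T) T, ‖G (σ + t * Complex.I)‖ₑ ^ 2 ≤ ENNReal.ofReal (C * T))
    {ε σ₁ : ℝ} (hε : 0 < ε) (hε1 : ε ≤ 1) :
    ∃ C : ℝ, 0 ≤ C ∧ ∀ N : ℕ, 1 ≤ N → ∀ σ ∈ Set.Icc (1 / 2 + ε) σ₁,
      ∫⁻ t in Set.Icc (0 : ℝ) N, ‖Real.log ‖G (σ + t * Complex.I)‖‖ₑ ^ 2 ≤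
        ENNReal.ofReal (C * N) := by
  -- The centre lies far enough right that `|G|` is bounded below there, that `σ₁ ≤ σ₀`, and that
  -- the radius satisfies `rε ≥ 2`.
  set σ₀ : ℝ := max 2 σ₁ + 2 / ε + 1 with hσ₀
  have h2ε : 2 ≤ 2 / ε := by rw [le_div_iff₀ hε]; linarith
  have hmax1 : 2 ≤ max 2 σ₁ := le_max_left _ _
  have hmax2 : σ₁ ≤ max 2 σ₁ := le_max_right _ _
  set r : ℝ := σ₀ - 1 / 2 - ε / 2 with hr
  have hr2 : 2 / ε + 1 ≤ r := by linarith
  have h2εr : 2 ≤ r * ε := by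
    rw [← div_le_iff₀ hε]
    linarith
  set R : ℝ := r + ε / 4 with hRdef
  obtain ⟨D, hD0, hD⟩ := exists_lintegral_log_sq_le_sq (r := r) (R' := r + ε / 8) (R := R)
    (by linarith) (by linarith) (by linarith) hc
  -- The discs of radius `r` and `R` reach left to `1/2 + ε/2` and `1/2 + ε/4`. A further margin `δ`
  -- stays right of `a = 1/2 + ε/8`, so the box `[a, b] × [n - K, n + K]` contains the
  -- `δ`-neighbourhood of the larger disc.
  set δ : ℝ := ε / 8 with hδ
  have hδ0 : 0 < δ := by positivity
  set b : ℝ := 2 * σ₀ with hb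
  set a : ℝ := 1 / 2 + δ with ha
  set K : ℕ := ⌈σ₀⌉₊ with hK
  have hKσ : σ₀ ≤ K := Nat.le_ceil _
  obtain ⟨C, hC0, hC⟩ := hms δ b hδ0
  set κ : ℝ := Real.pi * δ ^ 2 with hκ
  have hκ0 : 0 < κ := by positivity
  set I : ℕ → ENNReal := fun n => ∫⁻ σ in Set.Icc a b, ∫⁻ t in Set.Icc ((n : ℝ) - K) (n + K),
    ‖G ((σ : ℂ) + (t : ℂ) * Complex.I)‖ₑ ^ 2 with hI
  have hab : a ≤ b := by linarith
  have hgm : Measurable fun p : ℝ × ℝ => ‖G ((p.1 : ℂ) + (p.2 : ℂ) * Complex.I)‖ₑ ^ 2 := by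
    fun_prop
  have hsum : ∀ N : ℕ, 1 ≤ N → ∑ n ∈ Finset.range N, I n ≤
      ENNReal.ofReal ((b - a) * ((2 * K + 1 : ℕ) * (C * (1 + K))) * N) := by
    intro N hN
    have hN1 : (1 : ℝ) ≤ N := by exact_mod_cast hN
    have hK0 : (0 : ℝ) ≤ K := K.cast_nonneg
    rw [hI, ← lintegral_finsetSum]
    · calc _ ≤ ∫⁻ σ in Set.Icc a b, ENNReal.ofReal ((2 * K + 1 : ℕ) * (C * (N + K))) := by
            refine setLIntegral_mono' measurableSet_Icc fun σ hσ => ?_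
            refine (sum_lintegral_window_le (by fun_prop) N K).trans ?_
            rw [ENNReal.ofReal_mul (by positivity), ENNReal.ofReal_natCast]
            gcongr
            exact hC _ (by linarith) σ hσ
        _ ≤ _ := by
            rw [setLIntegral_const, Real.volume_Icc, ← ENNReal.ofReal_mul (by positivity)]
            apply ENNReal.ofReal_le_ofReal
            have : (N : ℝ) + K ≤ (1 + K) * N := by nlinarith
            calc (2 * K + 1 : ℕ) * (C * ((N : ℝ) + K)) * (b - a)
                ≤ (2 * K + 1 : ℕ) * (C * ((1 + K) * N)) * (b - a) := by
                  have : 0 ≤ b - a := by linarith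
                  gcongr
              _ = _ := by ring
    · intro n _
      exact hgm.lintegral_prod_right'
  refine ⟨D ^ 2 * (1 + (b - a) * ((2 * K + 1 : ℕ) * (C * (1 + K))) / κ), ?_, ?_⟩
  · have : 0 ≤ b - a := by linarith
    positivity
  intro N hN σ hσ
  have hfin : ∀ n ∈ Finset.range N, I n ≠ ⊤ := fun n hn =>
    ((Finset.single_le_sum (fun _ _ => zero_le) hn).trans_lt
      ((hsum N hN).trans_lt ENNReal.ofReal_lt_top)).ne
  have hwin : ∀ n ∈ Finset.range N,
      ∫⁻ t in Set.Icc (n : ℝ) (n + 1), ‖Real.log ‖G (σ + t * Complex.I)‖‖ₑ ^ 2 ≤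
        ENNReal.ofReal (D ^ 2) * (1 + I n / ENNReal.ofReal κ) := by
    intro n hn
    set w : ℂ := (σ₀ : ℂ) + n * Complex.I with hw
    have hwre : w.re = σ₀ := by simp [hw]
    have hwim : w.im = n := by simp [hw]
    set M : ℝ := Real.sqrt (1 + (I n).toReal / κ) with hM
    have hM1 : 1 ≤ M := by
      rw [hM, Real.one_le_sqrt]
      have : 0 ≤ (I n).toReal / κ := by positivity
      linarith
    have hM2 : M ^ 2 = 1 + (I n).toReal / κ := Real.sq_sqrt (by positivity)
    have hreg : ∀ z ∈ Metric.closedBall w R, |z.re - σ₀| ≤ R ∧ |z.im - n| ≤ R := by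
      intro z hz
      rw [mem_closedBall_iff_norm] at hz
      rw [← hwre, ← hwim, ← Complex.sub_re, ← Complex.sub_im]
      exact ⟨(Complex.abs_re_le_norm _).trans hz, (Complex.abs_im_le_norm _).trans hz⟩
    have hUo : IsOpen {s : ℂ | 0 < s.re} := isOpen_lt continuous_const Complex.continuous_re
    have hball : Metric.closedBall w R ⊆ {s : ℂ | 0 < s.re} := by
      intro z hz
      have := abs_le.1 (hreg z hz).1
      simp only [Set.mem_ofPred_eq]
      linarith
    have hGM : ∀ z ∈ Metric.closedBall w R, ‖G z‖ ≤ M := by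
      intro z hz
      have h1 := abs_le.1 (hreg z hz).1
      have h2 := abs_le.1 (hreg z hz).2
      have hsub : Metric.closedBall z δ ⊆ {s : ℂ | 0 < s.re} := by
        intro y hy
        rw [mem_closedBall_iff_norm] at hy
        have h3 := abs_le.1 ((Complex.abs_re_le_norm _).trans hy)
        rw [Complex.sub_re] at h3
        simp only [Set.mem_ofPred_eq]
        linarith
      have h4 := enorm_sq_le_lintegral_rectangle hm hδ0 (hd.mono hsub) (a := a) (b := b)
        (c := (n : ℝ) - K) (d := n + K) (by linarith) (by linarith) (by linarith) (by linarith)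
      have h5 := ENNReal.toReal_mono (hfin n hn) h4
      rw [ENNReal.toReal_mul, ENNReal.toReal_ofReal hκ0.le, ENNReal.toReal_pow, toReal_enorm] at h5
      apply le_of_sq_le_sq _ (by linarith)
      rw [hM2]
      have : ‖G z‖ ^ 2 ≤ (I n).toReal / κ := by
        rw [le_div_iff₀ hκ0]; linarith
      linarith
    have hx : ∀ t ∈ Set.Icc (0 : ℝ) 1, ‖((σ - σ₀ : ℝ) : ℂ) + t * Complex.I‖ ≤ r := by
      intro t ht
      exact norm_add_mul_I_le_of_sub_half_le hε hε1 h2εr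
        (by rw [abs_le]; constructor <;> linarith [hσ.1, hσ.2]) ht
    have := hD G _ w M hm hUo hball hd hM1 hGM (hlow w (by linarith)) (σ - σ₀) hx
    rw [setLIntegral_Icc_add_one_eq]
    have e : ∀ t : ℝ, w + (((σ - σ₀ : ℝ) : ℂ) + t * Complex.I) =
        (σ : ℂ) + ((n + t : ℝ) : ℂ) * Complex.I := by
      intro t
      rw [hw]
      push_cast
      ring
    simp only [e] at this
    refine this.trans (le_of_eq ?_)
    rw [← ENNReal.ofReal_pow (by positivity), mul_pow, hM2, ENNReal.ofReal_mul (by positivity),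
      ENNReal.ofReal_add zero_le_one (by positivity), ENNReal.ofReal_div_of_pos hκ0,
      ENNReal.ofReal_toReal (hfin n hn), ENNReal.ofReal_one]
  calc ∫⁻ t in Set.Icc (0 : ℝ) N, ‖Real.log ‖G (σ + t * Complex.I)‖‖ₑ ^ 2
      ≤ ∑ n ∈ Finset.range N,
        ∫⁻ t in Set.Icc (n : ℝ) (n + 1), ‖Real.log ‖G (σ + t * Complex.I)‖‖ₑ ^ 2 :=
        lintegral_Icc_zero_natCast_le_sum _ N
    _ ≤ ∑ n ∈ Finset.range N, ENNReal.ofReal (D ^ 2) * (1 + I n / ENNReal.ofReal κ) :=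
        Finset.sum_le_sum hwin
    _ = ENNReal.ofReal (D ^ 2) * (N + (∑ n ∈ Finset.range N, I n) / ENNReal.ofReal κ) := by
        rw [← Finset.mul_sum, Finset.sum_add_distrib]
        simp [div_eq_mul_inv, Finset.sum_mul]
    _ ≤ ENNReal.ofReal (D ^ 2) * (ENNReal.ofReal N +
        ENNReal.ofReal ((b - a) * ((2 * K + 1 : ℕ) * (C * (1 + K))) * N) / ENNReal.ofReal κ) := by
        rw [ENNReal.ofReal_natCast]
        gcongr
        exact hsum N hN
    _ = _ := by
        have : 0 ≤ b - a := by linarith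
        rw [← ENNReal.ofReal_div_of_pos hκ0, ← ENNReal.ofReal_add (by positivity) (by positivity),
          ← ENNReal.ofReal_mul (by positivity)]
        congr 1
        ring

/-! ### The Lerch zeta-function as a Mellin transform. -/

/-- The coefficients `e^{2πiλn}` of the Lerch series. -/
noncomputable def lerchCoeff (lam : ℝ) (n : ℕ) : ℂ :=
  Complex.exp (2 * Real.pi * Complex.I * lam * n)

/-- The summatory function `∑_{n + α ≤ x} e^{2πiλn}`. -/
noncomputable def lerchSummatory (lam α x : ℝ) : ℂ :=
  ∑ n ∈ Finset.range ⌊x + 1 - α⌋₊, lerchCoeff lam n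

theorem norm_lerchCoeff (lam : ℝ) (n : ℕ) : ‖lerchCoeff lam n‖ = 1 := by
  rw [lerchCoeff, Complex.norm_exp]
  simp

theorem lerchCoeff_intCast (k : ℤ) (n : ℕ) : lerchCoeff k n = 1 := by
  rw [lerchCoeff, Complex.exp_eq_one_iff]
  refine ⟨k * n, ?_⟩
  push_cast
  ring

theorem lt_floor_add_one_sub_iff {α x : ℝ} {n : ℕ} : n < ⌊x + 1 - α⌋₊ ↔ n + α ≤ x := by
  rw [← Nat.add_one_le_iff, Nat.le_floor_iff' (Nat.succ_ne_zero n)]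
  push_cast
  constructor <;> intro h <;> linarith

theorem floor_add_one_sub_eq_zero {α x : ℝ} (h : x < α) : ⌊x + 1 - α⌋₊ = 0 :=
  Nat.floor_eq_zero.2 (by linarith)

theorem lerchSummatory_eq_zero {lam α x : ℝ} (h : x < α) : lerchSummatory lam α x = 0 := by
  rw [lerchSummatory, floor_add_one_sub_eq_zero h, Finset.sum_range_zero]

theorem measurable_lerchSummatory (lam α : ℝ) : Measurable (lerchSummatory lam α) := by
  have h : Measurable fun N : ℕ => ∑ n ∈ Finset.range N, lerchCoeff lam n := measurable_from_nat
  exact h.comp (Nat.measurable_floor.comp (by fun_prop))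

theorem sum_lerchCoeff_indicator (lam α : ℝ) (N : ℕ) (x : ℝ) :
    ∑ n ∈ Finset.range N, lerchCoeff lam n * (Set.Ici ((n : ℝ) + α)).indicator 1 x =
      ∑ n ∈ Finset.range (min N ⌊x + 1 - α⌋₊), lerchCoeff lam n := by
  have : Finset.range (min N ⌊x + 1 - α⌋₊) =
      (Finset.range N).filter (fun n : ℕ => x ∈ Set.Ici ((n : ℝ) + α)) := by
    ext n
    simp only [Finset.mem_range, lt_min_iff, Finset.mem_filter, Set.mem_Ici,
      lt_floor_add_one_sub_iff]
  rw [this, Finset.sum_filter]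
  refine Finset.sum_congr rfl fun n _ => ?_
  split_ifs with h
  · rw [Set.indicator_of_mem h, Pi.one_apply, mul_one]
  · rw [Set.indicator_of_notMem h, mul_zero]

theorem hasMellin_indicator_Ici {c : ℝ} (hc : 0 < c) {s : ℂ} (hs : 0 < s.re) :
    HasMellin ((Set.Ici c).indicator (1 : ℝ → ℂ)) (-s) ((c : ℂ) ^ (-s) / s) := by
  have hre : (-s - 1).re < -1 := by simp; linarith
  have hs0 : s ≠ 0 := by rintro rfl; simp at hs
  have e : (fun t : ℝ => (t : ℂ) ^ (-s - 1) • (Set.Ici c).indicator (1 : ℝ → ℂ) t) =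
      (Set.Ici c).indicator (fun t : ℝ => (t : ℂ) ^ (-s - 1)) := by
    funext t
    by_cases h : t ∈ Set.Ici c
    · simp [Set.indicator_of_mem h]
    · simp [Set.indicator_of_notMem h]
  have hsub : Set.Ici c ⊆ Set.Ioi 0 := fun t ht => hc.trans_le ht
  constructor
  · rw [MellinConvergent, e, IntegrableOn, integrable_indicator_iff measurableSet_Ici,
      IntegrableOn, Measure.restrict_restrict measurableSet_Ici, Set.inter_eq_left.2 hsub]
    exact (integrableOn_Ici_iff_integrableOn_Ioi).2 (integrableOn_Ioi_cpow_of_lt hre hc)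
  · rw [mellin, e, setIntegral_indicator measurableSet_Ici, Set.inter_eq_right.2 hsub,
      integral_Ici_eq_integral_Ioi, integral_Ioi_cpow_of_lt hre hc]
    rw [show -s - 1 + 1 = -s by ring, neg_div_neg_eq]

/-- Partial summation in integral form: `(n + α)^{-s}` is `s` times the Mellin transform at `-s` of
the indicator of `[n + α, ∞)`. The `min` cuts the summatory function off after `N` terms. -/
theorem lerchPartialSum_eq_mul_mellin (lam : ℝ) {α : ℝ} (hα : 0 < α) {s : ℂ} (hs : 0 < s.re)
    (N : ℕ) : lerchPartialSum lam α s N =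
      s * mellin (fun x => ∑ n ∈ Finset.range (min N ⌊x + 1 - α⌋₊), lerchCoeff lam n) (-s) := by
  have hs0 : s ≠ 0 := by rintro rfl; simp at hs
  have hm : ∀ n : ℕ, HasMellin ((Set.Ici ((n : ℝ) + α)).indicator (1 : ℝ → ℂ)) (-s)
      ((((n : ℝ) + α : ℝ) : ℂ) ^ (-s) / s) := fun n => hasMellin_indicator_Ici (by positivity) hs
  simp only [← sum_lerchCoeff_indicator]
  rw [mellin]
  have e : ∀ t : ℝ, (t : ℂ) ^ (-s - 1) •
      ∑ n ∈ Finset.range N, lerchCoeff lam n * (Set.Ici ((n : ℝ) + α)).indicator 1 t =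
      ∑ n ∈ Finset.range N, lerchCoeff lam n *
        ((t : ℂ) ^ (-s - 1) • (Set.Ici ((n : ℝ) + α)).indicator (1 : ℝ → ℂ) t) := by
    intro t
    rw [Finset.smul_sum]
    refine Finset.sum_congr rfl fun n _ => ?_
    simp only [smul_eq_mul]
    ring
  simp only [e]
  rw [integral_finsetSum _ (fun n _ => ((hm n).1.integrable.const_mul _)), Finset.mul_sum,
    lerchPartialSum]
  refine Finset.sum_congr rfl fun n _ => ?_
  rw [integral_const_mul]
  have h2 := (hm n).2
  rw [mellin] at h2
  rw [h2, lerchCoeff, Complex.cpow_neg]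
  push_cast
  field_simp

/-- Dominated convergence: at fixed `x` the truncated sum is eventually constant in `N`, and `C x^{κ
- Re s - 1}` on `[α, ∞)` is a majorant. The exponent `κ = 1` serves integer `λ`, and `κ = 0` serves
the bounded exponential sums. -/
theorem tendsto_lerchPartialSum_mellin (lam : ℝ) {α : ℝ} (hα : 0 < α) {s : ℂ} (hs : 0 < s.re)
    {C κ : ℝ} (hκ : κ < s.re) (hC : ∀ (N : ℕ) (x : ℝ), α ≤ x →
      ‖∑ n ∈ Finset.range (min N ⌊x + 1 - α⌋₊), lerchCoeff lam n‖ ≤ C * x ^ κ) :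
    Tendsto (lerchPartialSum lam α s) atTop (𝓝 (s * mellin (lerchSummatory lam α) (-s))) ∧
      MellinConvergent (lerchSummatory lam α) (-s) := by
  set bound : ℝ → ℝ := (Set.Ici α).indicator (fun x => C * x ^ (κ - s.re - 1)) with hb
  have hsub : Set.Ici α ⊆ Set.Ioi 0 := fun t ht => hα.trans_le ht
  have hbi : IntegrableOn bound (Set.Ioi 0) := by
    rw [IntegrableOn, hb, integrable_indicator_iff measurableSet_Ici,
      IntegrableOn, Measure.restrict_restrict measurableSet_Ici, Set.inter_eq_left.2 hsub]
    exact (integrableOn_Ici_iff_integrableOn_Ioi).2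
      ((integrableOn_Ioi_rpow_of_lt (by linarith) hα).const_mul _)
  have hcm : Measurable fun t : ℝ => (t : ℂ) ^ (-s - 1) := by fun_prop
  have hbd : ∀ (N : ℕ) (t : ℝ), 0 < t → ‖(t : ℂ) ^ (-s - 1) •
      ∑ n ∈ Finset.range (min N ⌊t + 1 - α⌋₊), lerchCoeff lam n‖ ≤ bound t := by
    intro N t ht
    by_cases h : α ≤ t
    · rw [hb, Set.indicator_of_mem (show t ∈ Set.Ici α from h), norm_smul,
        Complex.norm_cpow_eq_rpow_re_of_pos ht]
      calc _ ≤ t ^ (-s - 1).re * (C * t ^ κ) := by gcongr; exact hC N t h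
        _ = C * (t ^ (-s - 1).re * t ^ κ) := by ring
        _ = _ := by
          rw [← Real.rpow_add ht]
          simp only [Complex.sub_re, Complex.neg_re, Complex.one_re]
          ring_nf
    · rw [floor_add_one_sub_eq_zero (not_le.1 h), min_zero, Finset.sum_range_zero, smul_zero,
        norm_zero, hb, Set.indicator_of_notMem (show t ∉ Set.Ici α from h)]
  have hmeasN : ∀ N : ℕ, Measurable fun t : ℝ =>
      ∑ n ∈ Finset.range (min N ⌊t + 1 - α⌋₊), lerchCoeff lam n := by
    intro N
    have h : Measurable fun m : ℕ => ∑ n ∈ Finset.range (min N m), lerchCoeff lam n :=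
      measurable_from_nat
    exact h.comp (Nat.measurable_floor.comp (by fun_prop))
  constructor
  · have : lerchPartialSum lam α s = fun N => s * mellin
        (fun x => ∑ n ∈ Finset.range (min N ⌊x + 1 - α⌋₊), lerchCoeff lam n) (-s) := by
      funext N
      exact lerchPartialSum_eq_mul_mellin lam hα hs N
    rw [this]
    refine Tendsto.const_mul s ?_
    refine tendsto_integral_of_dominated_convergence bound
      (fun N => (hcm.smul (hmeasN N)).aestronglyMeasurable) hbi (fun N => ?_) ?_
    · filter_upwards [ae_restrict_mem measurableSet_Ioi] with t ht
      exact hbd N t ht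
    · refine Eventually.of_forall fun t => tendsto_const_nhds.congr' ?_
      filter_upwards [eventually_ge_atTop ⌊t + 1 - α⌋₊] with N hN
      rw [min_eq_right hN, lerchSummatory]
  · refine Integrable.mono' hbi
      (hcm.smul (measurable_lerchSummatory lam α)).aestronglyMeasurable ?_
    filter_upwards [ae_restrict_mem measurableSet_Ioi] with t ht
    have := hbd ⌊t + 1 - α⌋₊ t ht
    rwa [min_self] at this

/-- The summatory function of the Lerch coefficients minus its main term `E (x - 1)⁺`. -/
noncomputable def lerchRemainder (lam α E x : ℝ) : ℂ :=
  lerchSummatory lam α x - ((E * max (x - 1) 0 : ℝ) : ℂ)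

theorem lerchRemainder_eq_zero {lam α E x : ℝ} (hα' : α ≤ 1) (h : x < α) :
    lerchRemainder lam α E x = 0 := by
  rw [lerchRemainder, lerchSummatory_eq_zero h, max_eq_right (by linarith)]
  simp

theorem measurable_lerchRemainder (lam α E : ℝ) : Measurable (lerchRemainder lam α E) :=
  (measurable_lerchSummatory lam α).sub (by fun_prop)

/-- The Mellin transform of a bounded function vanishing near `0` is holomorphic in `Re s < 0`. -/
theorem mellin_differentiableAt_of_bounded {f : ℝ → ℂ} (hf : Measurable f) {B α : ℝ} (hα : 0 < α)
    (hB : ∀ x, ‖f x‖ ≤ B) (h0 : ∀ x < α, f x = 0) {s : ℂ} (hs : s.re < 0) :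
    MellinConvergent f s ∧ DifferentiableAt ℂ (mellin f) s := by
  have hloc : LocallyIntegrableOn f (Set.Ioi 0) := by
    refine LocallyIntegrable.locallyIntegrableOn ?_ _
    refine (locallyIntegrable_const B).mono hf.aestronglyMeasurable (Eventually.of_forall fun x => ?_)
    exact (hB x).trans (le_abs_self B)
  have htop : f =O[atTop] fun x : ℝ => x ^ (-(0 : ℝ)) := by
    simp only [neg_zero, Real.rpow_zero]
    exact Asymptotics.IsBigO.of_bound B (Eventually.of_forall fun x => by simpa using hB x)
  have hbot : f =O[𝓝[>] 0] fun x : ℝ => x ^ (-(s.re - 1)) := by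
    refine Asymptotics.IsBigO.of_bound 0 ?_
    filter_upwards [nhdsWithin_le_nhds (Iio_mem_nhds hα)] with x hx
    rw [h0 x hx]
    simp
  exact ⟨mellinConvergent_of_isBigO_rpow hloc htop hs hbot (by linarith),
    mellin_differentiableAt_of_isBigO_rpow hloc htop hs hbot (by linarith)⟩

/-- The main term `(x - 1)⁺` is chosen because `s` times this transform is exactly `1/(s - 1)`, and
because it vanishes for `x < α ≤ 1`, so that the remainder does too. -/
theorem hasMellin_max_sub_one {s : ℂ} (hs : 1 < s.re) :
    HasMellin (fun x : ℝ => ((max (x - 1) 0 : ℝ) : ℂ)) (-s) (1 / (s - 1) - 1 / s) := by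
  have hs0 : s ≠ 0 := by rintro rfl; simp at hs; linarith
  have hs1 : s - 1 ≠ 0 := by intro h; rw [sub_eq_zero] at h; simp [h] at hs
  have h1 : (-s).re < -1 := by simp; linarith
  have h2 : (-s - 1).re < -1 := by simp; linarith
  have e : Set.EqOn (fun t : ℝ => (t : ℂ) ^ (-s - 1) • ((max (t - 1) 0 : ℝ) : ℂ))
      ((Set.Ioi 1).indicator (fun t : ℝ => (t : ℂ) ^ (-s) - (t : ℂ) ^ (-s - 1))) (Set.Ioi 0) := by
    intro t ht
    have ht0 : (t : ℂ) ≠ 0 := by exact_mod_cast (ne_of_gt ht)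
    by_cases h : t ∈ Set.Ioi 1
    · have h' : 1 < t := h
      simp only [Set.indicator_of_mem h]
      rw [max_eq_left (by linarith), show -s = (-s - 1) + 1 by ring, Complex.cpow_add _ _ ht0,
        Complex.cpow_one, smul_eq_mul]
      push_cast
      ring_nf
    · have h' : t ≤ 1 := not_lt.1 h
      simp only [Set.indicator_of_notMem h]
      rw [max_eq_right (by linarith)]
      simp
  have i1 := integrableOn_Ioi_cpow_of_lt h1 one_pos
  have i2 := integrableOn_Ioi_cpow_of_lt h2 one_pos
  have hsub : Set.Ioi (1 : ℝ) ⊆ Set.Ioi 0 := Set.Ioi_subset_Ioi zero_le_one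
  constructor
  · rw [MellinConvergent, integrableOn_congr_fun e measurableSet_Ioi, IntegrableOn,
      integrable_indicator_iff measurableSet_Ioi,
      IntegrableOn, Measure.restrict_restrict measurableSet_Ioi, Set.inter_eq_left.2 hsub]
    exact i1.sub i2
  · rw [mellin, setIntegral_congr_fun measurableSet_Ioi e, setIntegral_indicator measurableSet_Ioi,
      Set.inter_eq_right.2 hsub, integral_sub i1 i2, integral_Ioi_cpow_of_lt h1 one_pos,
      integral_Ioi_cpow_of_lt h2 one_pos]
    simp only [Complex.ofReal_one, Complex.one_cpow]
    rw [show -s + 1 = -(s - 1) by ring, show -s - 1 + 1 = -s by ring]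
    field_simp

theorem lerchSummatory_intCast (k : ℤ) (α x : ℝ) :
    lerchSummatory k α x = ((⌊x + 1 - α⌋₊ : ℝ) : ℂ) := by
  simp [lerchSummatory, lerchCoeff_intCast]

theorem norm_lerchRemainder_intCast_le (k : ℤ) {α : ℝ} (hα : 0 < α) (hα' : α ≤ 1) (x : ℝ) :
    ‖lerchRemainder k α 1 x‖ ≤ 3 := by
  rcases lt_or_ge x α with h | h
  · rw [lerchRemainder_eq_zero hα' h]; simp
  · rw [lerchRemainder, lerchSummatory_intCast, ← Complex.ofReal_sub, Complex.norm_real,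
      Real.norm_eq_abs, abs_le]
    have h1 := Nat.floor_le (show 0 ≤ x + 1 - α by linarith)
    have h2 := Nat.lt_floor_add_one (x + 1 - α)
    have h3 := le_max_left (x - 1) 0
    have h4 : max (x - 1) 0 ≤ x := max_le (by linarith) (by linarith)
    constructor <;> linarith

/-- The Hurwitz zeta function as a Mellin transform, in the half plane `Re s > 0`. -/
theorem lerchZeta_intCast_mul_sub_one (k : ℤ) {α : ℝ} (hα : 0 < α) (hα' : α ≤ 1) {s : ℂ}
    (hs : 0 < s.re) (hs1 : s ≠ 1) :
    lerchZeta k α s * (s - 1) = (s - 1) * (s * mellin (lerchRemainder k α 1) (-s)) + 1 := by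
  have hmel : ∀ z : ℂ, 0 < z.re → MellinConvergent (lerchRemainder k α 1) (-z) ∧
      DifferentiableAt ℂ (mellin (lerchRemainder k α 1)) (-z) := fun z hz =>
    mellin_differentiableAt_of_bounded (measurable_lerchRemainder _ _ _) hα
      (norm_lerchRemainder_intCast_le k hα hα') (fun x hx => lerchRemainder_eq_zero hα' hx)
      (by simpa using hz)
  have hone : ∀ z : ℂ, 1 < z.re →
      lerchZeta k α z * (z - 1) = (z - 1) * (z * mellin (lerchRemainder k α 1) (-z)) + 1 := by
    intro z hz
    have hz0 : z ≠ 0 := by rintro rfl; simp at hz; linarith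
    have hz1 : z - 1 ≠ 0 := by intro h; rw [sub_eq_zero] at h; simp [h] at hz
    obtain ⟨hlim, hconv⟩ := tendsto_lerchPartialSum_mellin k hα (s := z) (by linarith)
      (C := 1 / α) (κ := 1) hz (fun N x hx => by
        simp only [lerchCoeff_intCast, Finset.sum_const, Finset.card_range, nsmul_eq_mul, mul_one]
        rw [Complex.norm_natCast, Real.rpow_one]
        have h1 := Nat.floor_le (show 0 ≤ x + 1 - α by linarith)
        have h2 : ((min N ⌊x + 1 - α⌋₊ : ℕ) : ℝ) ≤ (⌊x + 1 - α⌋₊ : ℝ) := by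
          exact_mod_cast min_le_right _ _
        rw [one_div, inv_mul_eq_div, le_div_iff₀ hα]
        have h3 : ((min N ⌊x + 1 - α⌋₊ : ℕ) : ℝ) ≤ x + 1 - α := h2.trans h1
        nlinarith)
    have hsum := (hasSum_lerchZeta_of_int k α hα hα' z hz).tendsto_sum_nat
    have hpe : ∀ N, ∑ n ∈ Finset.range N, 1 / ((n : ℂ) + (α : ℂ)) ^ z =
        lerchPartialSum k α z N := by
      intro N
      refine Finset.sum_congr rfl fun n _ => ?_
      have := lerchCoeff_intCast k n
      rw [lerchCoeff] at this
      rw [this]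
    simp only [hpe] at hsum
    have hval := tendsto_nhds_unique hsum hlim
    have hmax := hasMellin_max_sub_one hz
    have hsubm := hasMellin_sub hconv hmax.1
    have hrem : (fun t => lerchSummatory k α t - ((max (t - 1) 0 : ℝ) : ℂ)) =
        lerchRemainder k α 1 := by
      funext t
      rw [lerchRemainder, one_mul]
    rw [hrem] at hsubm
    rw [hsubm.2, hmax.2, hval]
    field_simp
    ring
  set U : Set ℂ := {z | 0 < z.re} with hU
  have hUo : IsOpen U := isOpen_lt continuous_const Complex.continuous_re
  have hL : ∀ z, lerchZeta k α z = HurwitzZeta.hurwitzZeta (α : UnitAddCircle) z := by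
    intro z
    rw [lerchZeta, if_pos ⟨k, rfl⟩]
  -- `ζ(z, α) - 1/((z - 1) Γ_ℝ(z))` is differentiable at `1`, so `1/Γ_ℝ` is subtracted from both
  -- sides. The identity theorem then extends the equality from `Re z > 1` to `Re z > 0`.
  set F₁ : ℂ → ℂ := fun z => (z - 1) *
    (HurwitzZeta.hurwitzZeta (α : UnitAddCircle) z - 1 / (z - 1) / Complex.Gammaℝ z) with hF₁
  set F₂ : ℂ → ℂ := fun z => (z - 1) * (z * mellin (lerchRemainder k α 1) (-z)) + 1 -
    (Complex.Gammaℝ z)⁻¹ with hF₂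
  have hd1 : DifferentiableOn ℂ F₁ U := by
    intro z hz
    refine DifferentiableAt.differentiableWithinAt (DifferentiableAt.mul (by fun_prop) ?_)
    rcases eq_or_ne z 1 with rfl | hz1
    · exact HurwitzZeta.differentiableAt_hurwitzZeta_sub_one_div _
    · refine (HurwitzZeta.differentiableAt_hurwitzZeta _ hz1).sub ?_
      simp only [div_eq_mul_inv, one_mul]
      exact ((by fun_prop : DifferentiableAt ℂ (fun z : ℂ => z - 1) z).inv (sub_ne_zero.2 hz1)).mul
        (Complex.differentiable_Gammaℝ_inv z)
  have hd2 : DifferentiableOn ℂ F₂ U := by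
    intro z hz
    have h1 : DifferentiableAt ℂ (fun z => mellin (lerchRemainder k α 1) (-z)) z :=
      DifferentiableAt.comp (f := fun z : ℂ => -z) z (hmel z hz).2 (by fun_prop)
    have h2 := Complex.differentiable_Gammaℝ_inv z
    exact (((by fun_prop : DifferentiableAt ℂ (fun z : ℂ => z - 1) z).mul
      (differentiableAt_id.mul h1)).add_const 1 |>.sub h2).differentiableWithinAt
  have key : ∀ z : ℂ, z ≠ 1 → F₁ z = lerchZeta k α z * (z - 1) - (Complex.Gammaℝ z)⁻¹ := by
    intro z hz
    have := sub_ne_zero.2 hz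
    simp only [hF₁, hL]
    field_simp
  have heq : Set.EqOn F₁ F₂ U := by
    refine (hd1.analyticOnNhd hUo).eqOn_of_preconnected_of_eventuallyEq (hd2.analyticOnNhd hUo)
      (convex_halfSpace_re_gt 0).isPreconnected (z₀ := 2) (by simp [hU]) ?_
    have : {z : ℂ | 1 < z.re} ∈ 𝓝 (2 : ℂ) :=
      (isOpen_lt continuous_const Complex.continuous_re).mem_nhds (by simp)
    filter_upwards [this] with z hz
    have hz' : 1 < z.re := hz
    rw [key z (by rintro rfl; simp at hz'), hone z hz']
  have := heq (show s ∈ U from hs)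
  rw [key s hs1] at this
  simp only [hF₂] at this
  linear_combination this

theorem lerchZeta_eq_mul_mellin (lam : ℝ) (h : ¬ ∃ k : ℤ, (k : ℝ) = lam) {α : ℝ} (hα : 0 < α)
    {s : ℂ} (hs : 0 < s.re) :
    lerchZeta lam α s = s * mellin (lerchRemainder lam α 0) (-s) := by
  obtain ⟨B, hB⟩ := lerch_exp_sum_bounded lam h
  have hlim := (tendsto_lerchPartialSum_mellin lam hα hs (C := B) (κ := 0) hs
    (fun N x _ => by rw [Real.rpow_zero, mul_one]; exact hB _)).1
  have e : lerchRemainder lam α 0 = lerchSummatory lam α := by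
    funext x
    simp [lerchRemainder]
  rw [e]
  exact tendsto_nhds_unique (tendsto_lerchPartialSum lam α h hα s hs) hlim

/-- The Lerch zeta-function as a Mellin transform of a bounded function in `Re s > 0`. -/
theorem exists_lerchZeta_mul_sub_one_eq (lam : ℝ) {α : ℝ} (hα : 0 < α) (hα' : α ≤ 1) :
    ∃ E B : ℝ, 0 ≤ E ∧ E ≤ 1 ∧ (∀ x, ‖lerchRemainder lam α E x‖ ≤ B) ∧
      ∀ s : ℂ, 0 < s.re → s ≠ 1 → lerchZeta lam α s * (s - 1) =
        (s - 1) * (s * mellin (lerchRemainder lam α E) (-s)) + E := by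
  -- `E` is the residue at `s = 1`: one for integer `λ`, zero otherwise.
  by_cases h : ∃ k : ℤ, (k : ℝ) = lam
  · obtain ⟨k, rfl⟩ := h
    refine ⟨1, 3, zero_le_one, le_rfl, norm_lerchRemainder_intCast_le k hα hα', fun s hs hs1 => ?_⟩
    rw [Complex.ofReal_one]
    exact lerchZeta_intCast_mul_sub_one k hα hα' hs hs1
  · obtain ⟨B, hB⟩ := lerch_exp_sum_bounded lam h
    refine ⟨0, B, le_rfl, zero_le_one, fun x => ?_, fun s hs _ => ?_⟩
    · rw [lerchRemainder, zero_mul, Complex.ofReal_zero, sub_zero]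
      exact hB _
    · rw [lerchZeta_eq_mul_mellin lam h hα hs]
      push_cast
      ring

/-! ### The mean square on vertical lines. -/

/-- The right side counts the points `n + α` in `(x, y]`, each carrying a coefficient of modulus
one. As a series of indicators it can be integrated term by term. -/
theorem enorm_lerchSummatory_sub_le (lam α : ℝ) {x y : ℝ} (hxy : x ≤ y) :
    ‖lerchSummatory lam α y - lerchSummatory lam α x‖ₑ ≤
      ∑' n : ℕ, (Set.Ioc x y).indicator (1 : ℝ → ENNReal) (n + α) := by
  have hle : ⌊x + 1 - α⌋₊ ≤ ⌊y + 1 - α⌋₊ := Nat.floor_mono (by linarith)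
  rw [lerchSummatory, lerchSummatory, ← Finset.sum_Ico_eq_sub _ hle]
  refine (enorm_sum_le _ _).trans (le_trans ?_ (ENNReal.sum_le_tsum
    (Finset.Ico ⌊x + 1 - α⌋₊ ⌊y + 1 - α⌋₊)))
  refine Finset.sum_le_sum fun n hn => ?_
  rw [Finset.mem_Ico, lt_floor_add_one_sub_iff, ← not_lt, lt_floor_add_one_sub_iff] at hn
  rw [Set.indicator_of_mem
    (show (n : ℝ) + α ∈ Set.Ioc x y from ⟨not_le.1 hn.1, hn.2⟩), Pi.one_apply, ← ofReal_norm,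
    norm_lerchCoeff, ENNReal.ofReal_one]

/-- The variation of the remainder `S` over the multiplicative interval `(e^{-u}, e^{h-u}]`. -/
theorem enorm_lerchRemainder_sub_le (lam : ℝ) {α E h : ℝ} (hα : 0 < α) (hE : 0 ≤ E) (hE' : E ≤ 1)
    (hh : 0 < h) (hh1 : h ≤ 1) (u : ℝ) :
    ‖lerchRemainder lam α E (Real.exp h * Real.exp (-u)) -
        lerchRemainder lam α E (Real.exp (-u))‖ₑ ≤
      (∑' n : ℕ, (Set.Ioc (-Real.log (n + α)) (h - Real.log (n + α))).indicator
        (1 : ℝ → ENNReal) u) +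
      (Set.Iic 1).indicator (fun u => ENNReal.ofReal (2 * h * Real.exp (-u))) u := by
  set x := Real.exp (-u) with hx
  set y := Real.exp h * Real.exp (-u) with hy
  have hx0 : 0 < x := Real.exp_pos _
  have hxy : x ≤ y := le_mul_of_one_le_left hx0.le (Real.one_le_exp hh.le)
  have e : lerchRemainder lam α E y - lerchRemainder lam α E x =
      (lerchSummatory lam α y - lerchSummatory lam α x) -
        ((E * (max (y - 1) 0 - max (x - 1) 0) : ℝ) : ℂ) := by
    rw [lerchRemainder, lerchRemainder]
    push_cast
    ring
  rw [e]
  refine (enorm_sub_le).trans (add_le_add ?_ ?_)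
  · refine (enorm_lerchSummatory_sub_le lam α hxy).trans (ENNReal.tsum_le_tsum fun n => ?_)
    have hn : 0 < (n : ℝ) + α := by positivity
    refine Set.indicator_apply_le' (fun hmem => ?_) (fun _ => zero_le)
    rw [Set.indicator_of_mem, Pi.one_apply, Pi.one_apply]
    have h1 : -u < Real.log (n + α) := (Real.lt_log_iff_exp_lt hn).2 hmem.1
    have h2 : Real.log (n + α) ≤ h - u := by
      rw [Real.log_le_iff_le_exp hn, sub_eq_add_neg, Real.exp_add]
      exact hmem.2
    exact ⟨by linarith, by linarith⟩
  · have h1 : 0 ≤ max (y - 1) 0 - max (x - 1) 0 :=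
      sub_nonneg.2 (max_le_max (by linarith) le_rfl)
    have h3 : E * (max (y - 1) 0 - max (x - 1) 0) ≤ max (y - 1) 0 - max (x - 1) 0 :=
      mul_le_of_le_one_left h1 hE'
    rw [← ofReal_norm, Complex.norm_real, Real.norm_eq_abs, abs_of_nonneg (mul_nonneg hE h1)]
    by_cases hu : u ∈ Set.Iic (1 : ℝ)
    · rw [Set.indicator_of_mem hu]
      apply ENNReal.ofReal_le_ofReal
      have h2 : max (y - 1) 0 - max (x - 1) 0 ≤ y - x := by
        rcases le_total (y - 1) 0 with h | h
        · rw [max_eq_right h]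
          linarith [le_max_right (x - 1) 0]
        · rw [max_eq_left h]
          linarith [le_max_left (x - 1) 0]
      have h4 := Real.abs_exp_sub_one_le (x := h) (by rwa [abs_of_pos hh])
      rw [abs_of_pos hh] at h4
      have h5 : y - x = (Real.exp h - 1) * x := by rw [hy, hx]; ring
      have h6 : (Real.exp h - 1) * x ≤ 2 * h * x := by
        gcongr
        exact (le_abs_self _).trans h4
      linarith
    -- As `h ≤ 1 < u`, both arguments are at most `1`, where the main term vanishes.
    · have hu' : 1 < u := not_le.1 hu
      have hy1 : y ≤ 1 := by
        rw [hy, ← Real.exp_add, Real.exp_le_one_iff]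
        linarith
      rw [Set.indicator_of_notMem hu, max_eq_right (by linarith), max_eq_right (by linarith)]
      simp

theorem summable_add_one_rpow_neg {δ : ℝ} (hδ : 0 < δ) :
    Summable fun n : ℕ => ((n : ℝ) + 1) ^ (-(1 + 2 * δ)) := by
  have := (Real.summable_one_div_nat_add_rpow 1 (1 + 2 * δ)).2 (by linarith)
  refine this.congr fun n => ?_
  have hn : (0 : ℝ) < n + 1 := by positivity
  rw [abs_of_pos hn, one_div, Real.rpow_neg hn.le]

/-- The mean square of the multiplicative short interval variation of the remainder is `O(h)`. -/
theorem exists_lintegral_lerchRemainder_sub_sq_le (lam : ℝ) {α E B δ b : ℝ} (hα : 0 < α)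
    (hα' : α ≤ 1) (hE : 0 ≤ E) (hE' : E ≤ 1) (hB : ∀ x, ‖lerchRemainder lam α E x‖ ≤ B)
    (hδ : 0 < δ) (hb : 0 ≤ b) :
    ∃ C : ℝ, 0 ≤ C ∧ ∀ h : ℝ, 0 < h → h ≤ 1 → ∀ σ ∈ Set.Icc (1 / 2 + δ) b,
      ∫⁻ u : ℝ, ‖Real.exp (σ * u) • (lerchRemainder lam α E (Real.exp h * Real.exp (-u)) -
        lerchRemainder lam α E (Real.exp (-u)))‖ₑ ^ 2 ≤ ENNReal.ofReal (C * h) := by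
  have hB0 : 0 ≤ B := (norm_nonneg _).trans (hB 0)
  set J : ℝ := ∫ u in Set.Iic (1 : ℝ), Real.exp (2 * δ * u) with hJ
  have hJ0 : 0 ≤ J := integral_nonneg fun u => (Real.exp_pos _).le
  have hJi := integrableOn_exp_mul_Iic (a := 2 * δ) (by linarith) 1
  set Z : ℝ := ∑' n : ℕ, ((n : ℝ) + 1) ^ (-(1 + 2 * δ)) with hZ
  have hZs := summable_add_one_rpow_neg hδ
  have hZ0 : 0 ≤ Z := tsum_nonneg fun n => by positivity
  set W : ℝ := Real.exp (2 * b) * α ^ (-(2 * b)) with hW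
  have hW0 : 0 ≤ W := by positivity
  refine ⟨2 * B * (W * Z + 2 * Real.exp (2 * b) * J), by positivity, ?_⟩
  intro h hh hh1 σ hσ
  set V : ℝ → ENNReal := fun u =>
    (∑' n : ℕ, (Set.Ioc (-Real.log (n + α)) (h - Real.log (n + α))).indicator
        (1 : ℝ → ENNReal) u) +
      (Set.Iic 1).indicator (fun u => ENNReal.ofReal (2 * h * Real.exp (-u))) u with hV
  -- `|D|² ≤ 2B |D|`: boundedness of the remainder reduces the mean square to an `L¹` norm, which is
  -- of order `h`.
  have hpt : ∀ u : ℝ, ‖Real.exp (σ * u) • (lerchRemainder lam α E (Real.exp h * Real.exp (-u)) -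
        lerchRemainder lam α E (Real.exp (-u)))‖ₑ ^ 2 ≤
      ENNReal.ofReal (2 * B) * (ENNReal.ofReal (Real.exp (2 * σ * u)) * V u) := by
    intro u
    set D := lerchRemainder lam α E (Real.exp h * Real.exp (-u)) -
        lerchRemainder lam α E (Real.exp (-u)) with hD
    have h1 : ‖D‖ₑ ≤ ENNReal.ofReal (2 * B) := by
      rw [← ofReal_norm]
      apply ENNReal.ofReal_le_ofReal
      refine (norm_sub_le _ _).trans ?_
      linarith [hB (Real.exp h * Real.exp (-u)), hB (Real.exp (-u))]
    have h2 : ‖D‖ₑ ≤ V u := enorm_lerchRemainder_sub_le lam hα hE hE' hh hh1 u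
    have h3 : ‖Real.exp (σ * u)‖ₑ ^ 2 = ENNReal.ofReal (Real.exp (2 * σ * u)) := by
      rw [Real.enorm_eq_ofReal (Real.exp_pos _).le, ← ENNReal.ofReal_pow (Real.exp_pos _).le,
        ← Real.exp_nat_mul]
      push_cast
      ring_nf
    rw [enorm_smul, mul_pow, h3, sq ‖D‖ₑ, mul_left_comm]
    gcongr
  have hind : ∀ n : ℕ, ∫⁻ u : ℝ, ENNReal.ofReal (Real.exp (2 * σ * u)) *
      (Set.Ioc (-Real.log (n + α)) (h - Real.log (n + α))).indicator (1 : ℝ → ENNReal) u ≤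
      ENNReal.ofReal (W * h * ((n : ℝ) + 1) ^ (-(1 + 2 * δ))) := by
    intro n
    have hn : (0 : ℝ) < n + α := by positivity
    have hn1 : (0 : ℝ) < n + 1 := by positivity
    set ℓ := Real.log (n + α) with hℓ
    -- Splitting off `α` leaves the base `(n + α)/α ≥ n + 1 ≥ 1`, so the exponent `2σ` can be
    -- lowered to `1 + 2δ`, uniformly in `σ`.
    have hbound : Real.exp (2 * σ * (h - ℓ)) ≤ W * ((n : ℝ) + 1) ^ (-(1 + 2 * δ)) := by
      have h1 : Real.exp (2 * σ * (h - ℓ)) =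
          Real.exp (2 * σ * h) * (α ^ (-(2 * σ)) * ((n + α) / α) ^ (-(2 * σ))) := by
        rw [← Real.mul_rpow hα.le (by positivity), mul_div_cancel₀ _ hα.ne', hℓ,
          Real.rpow_def_of_pos hn, ← Real.exp_add]
        ring_nf
      have h2 : (n : ℝ) + 1 ≤ (n + α) / α := by
        rw [le_div_iff₀ hα]
        have : (n : ℝ) * α ≤ n := mul_le_of_le_one_right (by positivity) hα'
        linarith
      have hσ0 : 0 ≤ σ := by linarith [hσ.1]
      rw [h1, hW, mul_assoc (Real.exp (2 * b))]
      gcongr ?_ * (?_ * ?_)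
      · apply Real.exp_le_exp.2
        nlinarith [hσ.2]
      · exact Real.rpow_le_rpow_of_exponent_ge hα hα' (by linarith [hσ.2])
      · calc ((n + α) / α) ^ (-(2 * σ)) ≤ ((n : ℝ) + 1) ^ (-(2 * σ)) :=
              Real.rpow_le_rpow_of_nonpos hn1 h2 (by linarith)
          _ ≤ _ := Real.rpow_le_rpow_of_exponent_le (by linarith [(n.cast_nonneg : (0 : ℝ) ≤ n)])
              (by linarith [hσ.1])
    calc _ ≤ ∫⁻ u : ℝ, (Set.Ioc (-ℓ) (h - ℓ)).indicator
          (fun _ => ENNReal.ofReal (W * ((n : ℝ) + 1) ^ (-(1 + 2 * δ)))) u := by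
          refine lintegral_mono fun u => ?_
          by_cases hu : u ∈ Set.Ioc (-ℓ) (h - ℓ)
          · rw [Set.indicator_of_mem hu, Set.indicator_of_mem hu, Pi.one_apply, mul_one]
            apply ENNReal.ofReal_le_ofReal
            refine le_trans (Real.exp_le_exp.2 ?_) hbound
            have : 0 ≤ 2 * σ := by linarith [hσ.1]
            exact mul_le_mul_of_nonneg_left hu.2 this
          · rw [Set.indicator_of_notMem hu, mul_zero]
            exact zero_le
      _ = _ := by
          rw [lintegral_indicator measurableSet_Ioc, setLIntegral_const, Real.volume_Ioc,
            ← ENNReal.ofReal_mul (by positivity)]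
          congr 1
          ring
  have hmain : ∫⁻ u : ℝ, ENNReal.ofReal (Real.exp (2 * σ * u)) *
      (Set.Iic 1).indicator (fun u => ENNReal.ofReal (2 * h * Real.exp (-u))) u ≤
      ENNReal.ofReal (2 * h * Real.exp (2 * b) * J) := by
    calc _ ≤ ∫⁻ u in Set.Iic (1 : ℝ), ENNReal.ofReal
          (2 * h * Real.exp (2 * b) * Real.exp (2 * δ * u)) := by
          rw [← lintegral_indicator measurableSet_Iic]
          refine lintegral_mono fun u => ?_
          by_cases hu : u ∈ Set.Iic (1 : ℝ)
          · rw [Set.indicator_of_mem hu, Set.indicator_of_mem hu,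
              ← ENNReal.ofReal_mul (Real.exp_pos _).le]
            apply ENNReal.ofReal_le_ofReal
            have h1 : Real.exp (2 * σ * u) * (2 * h * Real.exp (-u)) =
                2 * h * Real.exp (2 * σ * u + -u) := by
              rw [Real.exp_add]; ring
            rw [h1, mul_assoc (2 * h), ← Real.exp_add]
            have hu' : u ≤ 1 := hu
            refine mul_le_mul_of_nonneg_left (Real.exp_le_exp.2 ?_) (by positivity)
            nlinarith [hσ.1, hσ.2, mul_nonneg (sub_nonneg.2 hσ.1) (sub_nonneg.2 hu')]
          · rw [Set.indicator_of_notMem hu, mul_zero]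
            exact zero_le
      _ = _ := by
          rw [← ofReal_integral_eq_lintegral_ofReal (hJi.const_mul _)
            (Eventually.of_forall fun u => by simp only [Pi.zero_apply]; positivity),
            integral_const_mul]
  calc _ ≤ ∫⁻ u : ℝ, ENNReal.ofReal (2 * B) * (ENNReal.ofReal (Real.exp (2 * σ * u)) * V u) :=
        lintegral_mono hpt
    _ = ENNReal.ofReal (2 * B) * ((∑' n : ℕ, ∫⁻ u : ℝ, ENNReal.ofReal (Real.exp (2 * σ * u)) *
          (Set.Ioc (-Real.log (n + α)) (h - Real.log (n + α))).indicator (1 : ℝ → ENNReal) u) +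
        ∫⁻ u : ℝ, ENNReal.ofReal (Real.exp (2 * σ * u)) *
          (Set.Iic 1).indicator (fun u => ENNReal.ofReal (2 * h * Real.exp (-u))) u) := by
        have hm1 : Measurable fun u : ℝ => ENNReal.ofReal (Real.exp (2 * σ * u)) := by fun_prop
        have hm2 : ∀ n : ℕ, Measurable ((Set.Ioc (-Real.log (n + α))
            (h - Real.log (n + α))).indicator (1 : ℝ → ENNReal)) := fun n =>
          measurable_one.indicator measurableSet_Ioc
        have hm3 : Measurable ((Set.Iic (1 : ℝ)).indicator
            (fun u => ENNReal.ofReal (2 * h * Real.exp (-u)))) :=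
          Measurable.indicator (by fun_prop) measurableSet_Iic
        rw [lintegral_const_mul' _ _ ENNReal.ofReal_ne_top]
        congr 1
        have hm12 : ∀ n : ℕ, AEMeasurable (fun u : ℝ => ENNReal.ofReal (Real.exp (2 * σ * u)) *
            (Set.Ioc (-Real.log (n + α)) (h - Real.log (n + α))).indicator (1 : ℝ → ENNReal) u)
            volume := fun n => (hm1.mul (hm2 n)).aemeasurable
        have hm13 : Measurable (fun u : ℝ => ENNReal.ofReal (Real.exp (2 * σ * u)) *
            (Set.Iic 1).indicator (fun u => ENNReal.ofReal (2 * h * Real.exp (-u))) u) :=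
          hm1.mul hm3
        rw [← lintegral_tsum hm12, ← lintegral_add_right _ hm13]
        refine lintegral_congr fun u => ?_
        rw [hV, mul_add, ENNReal.tsum_mul_left]
    _ ≤ ENNReal.ofReal (2 * B) * (ENNReal.ofReal (W * h * Z) +
          ENNReal.ofReal (2 * h * Real.exp (2 * b) * J)) := by
        gcongr
        rw [hZ, ← tsum_mul_left, ENNReal.ofReal_tsum_of_nonneg (fun n => by positivity)
          (hZs.mul_left _)]
        exact ENNReal.tsum_le_tsum hind
    _ = _ := by
        rw [← ENNReal.ofReal_add (by positivity) (by positivity),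
          ← ENNReal.ofReal_mul (by positivity)]
        congr 1
        ring

open FourierTransform in
/-- The mean square of the Mellin transform on vertical segments near the real axis, in terms of
the multiplicative short interval variation. -/
theorem lintegral_mul_mellin_sq_le {S : ℝ → ℂ} (hS : Measurable S) {B α : ℝ} (hα : 0 < α)
    (hB : ∀ x, ‖S x‖ ≤ B) (h0 : ∀ x < α, S x = 0) {σ T h : ℝ} (hσ : 0 < σ) (hh : 0 < h)
    (hT : h * (σ + T) ≤ 1 / 2) :
    ∫⁻ t in Set.Icc (-T) T, ‖((σ : ℂ) + t * Complex.I) *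
        mellin S (-((σ : ℂ) + t * Complex.I))‖ₑ ^ 2 ≤
      ENNReal.ofReal (8 * Real.pi / h ^ 2) * ∫⁻ u : ℝ, ‖Real.exp (σ * u) •
        (S (Real.exp h * Real.exp (-u)) - S (Real.exp (-u)))‖ₑ ^ 2 := by
  set g : ℝ → ℂ := fun u => Real.exp (σ * u) •
        (S (Real.exp h * Real.exp (-u)) - S (Real.exp (-u))) with hg
  have hB0 : 0 ≤ B := (norm_nonneg _).trans (hB 0)
  have hgm : Measurable g := by fun_prop
  have hgb : ∀ u, ‖g u‖ ≤
      (Set.Iic (h - Real.log α)).indicator (fun u => 2 * B * Real.exp (σ * u)) u := by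
    intro u
    by_cases hu : u ∈ Set.Iic (h - Real.log α)
    · rw [Set.indicator_of_mem hu, hg, norm_smul, Real.norm_eq_abs, abs_of_pos (Real.exp_pos _),
        mul_comm]
      gcongr
      refine (norm_sub_le _ _).trans ?_
      linarith [hB (Real.exp h * Real.exp (-u)), hB (Real.exp (-u))]
    · have hu' : h - Real.log α < u := not_le.1 hu
      have h1 : Real.exp (-u) < α := by
        rw [← Real.lt_log_iff_exp_lt hα]; linarith
      have h2 : Real.exp h * Real.exp (-u) < α := by
        rw [← Real.exp_add, ← Real.lt_log_iff_exp_lt hα]; linarith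
      rw [Set.indicator_of_notMem hu, hg]
      simp only [h0 _ h1, h0 _ h2, sub_zero, smul_zero, norm_zero, le_refl]
  have hg1 : Integrable g := by
    refine Integrable.mono' ?_ hgm.aestronglyMeasurable (Eventually.of_forall hgb)
    rw [integrable_indicator_iff measurableSet_Iic]
    exact (integrableOn_exp_mul_Iic hσ _).const_mul _
  have hg2 : MemLp g 2 := by
    rw [memLp_two_iff_integrable_sq_norm hgm.aestronglyMeasurable]
    have hi : Integrable ((Set.Iic (h - Real.log α)).indicator
        (fun u => 4 * B ^ 2 * Real.exp ((2 * σ) * u))) := by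
      rw [integrable_indicator_iff measurableSet_Iic]
      exact (integrableOn_exp_mul_Iic (by linarith) _).const_mul _
    refine Integrable.mono' hi (by fun_prop) (Eventually.of_forall fun u => ?_)
    rw [Real.norm_eq_abs, abs_of_nonneg (sq_nonneg _)]
    refine (pow_le_pow_left₀ (norm_nonneg _) (hgb u) 2).trans (le_of_eq ?_)
    by_cases hu : u ∈ Set.Iic (h - Real.log α)
    · rw [Set.indicator_of_mem hu, Set.indicator_of_mem hu, mul_pow, ← Real.exp_nat_mul]
      push_cast
      ring_nf
    · rw [Set.indicator_of_notMem hu, Set.indicator_of_notMem hu, zero_pow two_ne_zero]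
  have hpl : ∫⁻ ξ, ‖𝓕 g ξ‖ₑ ^ 2 = ∫⁻ u, ‖g u‖ₑ ^ 2 := by
    have h1 := eLpNorm_nnreal_pow_eq_lintegral (f := 𝓕 g) (μ := volume) (p := 2) (by norm_num)
    have h2 := eLpNorm_nnreal_pow_eq_lintegral (f := g) (μ := volume) (p := 2) (by norm_num)
    have h3 := eLpNorm_fourier_eq_of_integrable hg1 hg2
    norm_num at h1 h2
    rw [← h1, ← h2, h3]
  -- The substitution `x = e^{-u}` turns the Mellin transform on the line into a Fourier transform
  -- with weight `e^{σu}`.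
  have hmel : ∀ t : ℝ, mellin (fun x => S (Real.exp h * x) - S x) (-((σ : ℂ) + t * Complex.I)) =
      𝓕 g (-t / (2 * Real.pi)) := by
    intro t
    rw [mellin_eq_fourier]
    simp [hg]
  have hdiff : ∀ t : ℝ, mellin (fun x => S (Real.exp h * x) - S x) (-((σ : ℂ) + t * Complex.I)) =
      (Complex.exp (h * ((σ : ℂ) + t * Complex.I)) - 1) * mellin S (-((σ : ℂ) + t * Complex.I)) := by
    intro t
    have hc := (mellin_differentiableAt_of_bounded hS hα hB h0
      (s := -((σ : ℂ) + t * Complex.I)) (by simpa using hσ)).1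
    have hc' := (MellinConvergent.comp_mul_left (Real.exp_pos h)).2 hc
    rw [(hasMellin_sub hc' hc).2, mellin_comp_mul_left _ _ (Real.exp_pos h), neg_neg, smul_eq_mul,
      Complex.cpow_def_of_ne_zero (by exact_mod_cast (Real.exp_pos h).ne'),
      ← Complex.ofReal_log (Real.exp_pos h).le, Real.log_exp]
    ring
  have hpt : ∀ t ∈ Set.Icc (-T) T, ‖((σ : ℂ) + t * Complex.I) *
      mellin S (-((σ : ℂ) + t * Complex.I))‖ₑ ^ 2 ≤
      ENNReal.ofReal (4 / h ^ 2) * ‖𝓕 g (-t / (2 * Real.pi))‖ₑ ^ 2 := by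
    intro t ht
    rw [← hmel, hdiff]
    set s : ℂ := (σ : ℂ) + t * Complex.I with hs
    have hsn : ‖s‖ ≤ σ + T := by
      refine (norm_add_le _ _).trans ?_
      rw [norm_mul, Complex.norm_I, mul_one, Complex.norm_real, Complex.norm_real,
        Real.norm_eq_abs, Real.norm_eq_abs, abs_of_pos hσ]
      gcongr
      exact abs_le.2 ht
    have hhs : ‖(h : ℂ) * s‖ ≤ 1 / 2 := by
      rw [norm_mul, Complex.norm_real, Real.norm_eq_abs, abs_of_pos hh]
      exact (mul_le_mul_of_nonneg_left hsn hh.le).trans hT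
    have h1 := Complex.norm_exp_sub_one_sub_id_le (hhs.trans (by norm_num))
    -- From `|e^z - 1 - z| ≤ |z|² ≤ |z|/2` when `|z| ≤ 1/2`.
    have h2 : ‖(h : ℂ) * s‖ / 2 ≤ ‖Complex.exp (h * s) - 1‖ := by
      have h3 := norm_sub_norm_le ((h : ℂ) * s) ((h : ℂ) * s - (Complex.exp (h * s) - 1))
      rw [sub_sub_cancel] at h3
      rw [← norm_neg, neg_sub] at h1
      have h4 : ‖(h : ℂ) * s‖ ^ 2 ≤ ‖(h : ℂ) * s‖ / 2 := by
        nlinarith [norm_nonneg ((h : ℂ) * s)]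
      linarith
    rw [norm_mul, Complex.norm_real, Real.norm_eq_abs, abs_of_pos hh] at h2
    have h5 : ‖s * mellin S (-s)‖ ≤ 2 / h * ‖(Complex.exp (h * s) - 1) * mellin S (-s)‖ := by
      rw [norm_mul, norm_mul, ← mul_assoc]
      gcongr
      rw [div_mul_eq_mul_div, le_div_iff₀ hh]
      linarith
    rw [← ofReal_norm, ← ofReal_norm, ← ENNReal.ofReal_pow (norm_nonneg _),
      ← ENNReal.ofReal_pow (norm_nonneg _), ← ENNReal.ofReal_mul (by positivity)]
    apply ENNReal.ofReal_le_ofReal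
    refine (pow_le_pow_left₀ (norm_nonneg _) h5 2).trans (le_of_eq ?_)
    rw [mul_pow, div_pow]
    norm_num
  have hFm : Measurable fun ξ => ‖𝓕 g ξ‖ₑ ^ 2 := by
    have hcont : Continuous (𝓕 g) :=
      VectorFourier.fourierIntegral_continuous Real.continuous_fourierChar
        (by exact continuous_inner) hg1
    exact hcont.measurable.enorm.pow_const 2
  -- The change of variable contributes `2π`, which with `4/h²` makes the constant `8π/h²`.
  have hscale : ∫⁻ t : ℝ, ‖𝓕 g (-t / (2 * Real.pi))‖ₑ ^ 2 =
      ENNReal.ofReal (2 * Real.pi) * ∫⁻ ξ, ‖𝓕 g ξ‖ₑ ^ 2 := by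
    have ha : -(2 * Real.pi)⁻¹ ≠ 0 := neg_ne_zero.2 (by positivity)
    have := lintegral_map (μ := volume) hFm (measurable_const_mul (-(2 * Real.pi)⁻¹))
    rw [Real.map_volume_mul_left ha, lintegral_smul_measure] at this
    rw [← inv_neg, inv_inv, abs_neg, abs_of_pos Real.two_pi_pos, smul_eq_mul] at this
    rw [this]
    refine lintegral_congr fun t => ?_
    congr 3
    field_simp
  calc _ ≤ ∫⁻ t in Set.Icc (-T) T,
        ENNReal.ofReal (4 / h ^ 2) * ‖𝓕 g (-t / (2 * Real.pi))‖ₑ ^ 2 :=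
        setLIntegral_mono' measurableSet_Icc hpt
    _ ≤ ∫⁻ t, ENNReal.ofReal (4 / h ^ 2) * ‖𝓕 g (-t / (2 * Real.pi))‖ₑ ^ 2 :=
        setLIntegral_le_lintegral _ _
    _ = _ := by
        rw [lintegral_const_mul' _ _ ENNReal.ofReal_ne_top, hscale, hpl, ← mul_assoc,
          ← ENNReal.ofReal_mul (by positivity)]
        congr 2
        ring

/-- The mean square bound for the Lerch zeta-function without its polar part. -/
theorem exists_lintegral_mul_mellin_lerchRemainder_sq_le (lam : ℝ) {α E B δ : ℝ} (hα : 0 < α)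
    (hα' : α ≤ 1) (hE : 0 ≤ E) (hE' : E ≤ 1) (hB : ∀ x, ‖lerchRemainder lam α E x‖ ≤ B)
    (hδ : 0 < δ) (b : ℝ) :
    ∃ C : ℝ, 0 ≤ C ∧ ∀ T : ℝ, 1 ≤ T → ∀ σ ∈ Set.Icc (1 / 2 + δ) b,
      ∫⁻ t in Set.Icc (-T) T, ‖((σ : ℂ) + t * Complex.I) *
        mellin (lerchRemainder lam α E) (-((σ : ℂ) + t * Complex.I))‖ₑ ^ 2 ≤
        ENNReal.ofReal (C * T) := by
  rcases lt_or_ge b 0 with hb | hb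
  · exact ⟨0, le_rfl, fun T _ σ hσ => absurd (hσ.1.trans hσ.2) (by linarith)⟩
  obtain ⟨C, hC0, hC⟩ := exists_lintegral_lerchRemainder_sub_sq_le lam hα hα' hE hE' hB hδ hb
  refine ⟨16 * Real.pi * C * (1 + b), by positivity, fun T hT σ hσ => ?_⟩
  have hT0 : 0 < T := by linarith
  -- The largest `h` with `h(σ + T) ≤ 1/2` for every `σ ≤ b`.
  set h : ℝ := 1 / (2 * (b + T)) with hh
  have hh0 : 0 < h := by positivity
  have hh1 : h ≤ 1 := by
    rw [hh, div_le_one (by positivity)]; linarith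
  have hhT : h * (σ + T) ≤ 1 / 2 := by
    calc h * (σ + T) ≤ h * (b + T) := by gcongr; exact hσ.2
      _ = 1 / 2 := by rw [hh]; field_simp
  refine (lintegral_mul_mellin_sq_le (measurable_lerchRemainder lam α E) hα hB
    (fun x hx => lerchRemainder_eq_zero hα' hx) (by linarith [hσ.1]) hh0 hhT).trans ?_
  refine (mul_le_mul_right (hC h hh0 hh1 σ hσ) _).trans ?_
  rw [← ENNReal.ofReal_mul (by positivity)]
  apply ENNReal.ofReal_le_ofReal
  have e : 8 * Real.pi / h ^ 2 * (C * h) = 16 * Real.pi * C * (b + T) := by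
    rw [hh]; field_simp; ring
  rw [e, mul_assoc _ (1 + b)]
  gcongr
  nlinarith

/-! ### The lower bound in `Re s ≥ 2` and the holomorphic companion. -/

theorem sum_one_div_add_two_sq_le (N : ℕ) :
    ∑ n ∈ Finset.range N, 1 / ((n : ℝ) + 2) ^ 2 ≤ 2 / 3 := by
  have h1 := hasSum_zeta_two.summable.sum_le_tsum (Finset.range (N + 2))
    (fun n _ => by positivity)
  rw [hasSum_zeta_two.tsum_eq, Finset.sum_range_succ', Finset.sum_range_succ'] at h1
  have h2 : Real.pi ^ 2 / 6 ≤ 5 / 3 := by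
    nlinarith [Real.pi_lt_d2, Real.pi_pos]
  have e : ∀ n : ℕ, 1 / (((n + 1 + 1 : ℕ)) : ℝ) ^ 2 = 1 / ((n : ℝ) + 2) ^ 2 := by
    intro n
    push_cast
    ring_nf
  simp only [e] at h1
  norm_num at h1
  norm_num
  linarith

/-- The Lerch zeta-function is bounded away from zero in `Re s ≥ 2`. -/
theorem one_third_le_norm_lerchZeta (lam : ℝ) {α : ℝ} (hα : 0 < α) (hα' : α ≤ 1) {s : ℂ}
    (hs : 2 ≤ s.re) : 1 / 3 ≤ ‖lerchZeta lam α s‖ := by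
  have hlim : Tendsto (lerchPartialSum lam α s) atTop (𝓝 (lerchZeta lam α s)) := by
    by_cases h : ∃ k : ℤ, (k : ℝ) = lam
    · obtain ⟨k, rfl⟩ := h
      refine (hasSum_lerchZeta_of_int k α hα hα' s (by linarith)).tendsto_sum_nat.congr fun N => ?_
      refine Finset.sum_congr rfl fun n _ => ?_
      have := lerchCoeff_intCast k n
      rw [lerchCoeff] at this
      rw [this]
    · exact tendsto_lerchPartialSum lam α h hα s (by linarith)
  refine ge_of_tendsto ((tendsto_add_atTop_iff_nat 1).2 hlim).norm (Eventually.of_forall fun N => ?_)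
  have hterm : ∀ n : ℕ, ‖lerchCoeff lam n / ((n : ℂ) + (α : ℂ)) ^ s‖ =
      ((n : ℝ) + α) ^ (-s.re) := by
    intro n
    have hn : (0 : ℝ) < n + α := by positivity
    have e : (n : ℂ) + (α : ℂ) = (((n : ℝ) + α : ℝ) : ℂ) := by push_cast; rfl
    rw [norm_div, norm_lerchCoeff, e, Complex.norm_cpow_eq_rpow_re_of_pos hn, Real.rpow_neg hn.le,
      one_div]
  have hα1 : 1 ≤ α ^ (-s.re) :=
    Real.one_le_rpow_of_pos_of_le_one_of_nonpos hα hα' (by linarith)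
  -- The tail is at most `2/3` of the leading term `α^{-Re s} ≥ 1`, because `∑_{m ≥ 2} m^{-2} = π²/6
  -- - 1 ≤ 2/3`.
  have htail : ‖∑ n ∈ Finset.range N,
      lerchCoeff lam (n + 1) / (((n + 1 : ℕ) : ℂ) + (α : ℂ)) ^ s‖ ≤ α ^ (-s.re) * (2 / 3) := by
    refine (norm_sum_le _ _).trans ?_
    calc _ ≤ ∑ n ∈ Finset.range N, α ^ (-s.re) * (1 / ((n : ℝ) + 2) ^ 2) := by
          refine Finset.sum_le_sum fun n _ => ?_
          rw [hterm]
          have hn : (0 : ℝ) < n + 2 := by positivity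
          have h1 : (n : ℝ) + 2 ≤ (((n + 1 : ℕ) : ℝ) + α) / α := by
            rw [le_div_iff₀ hα]
            push_cast
            nlinarith [(n.cast_nonneg : (0 : ℝ) ≤ n)]
          have h2 : (((n + 1 : ℕ) : ℝ) + α) = α * ((((n + 1 : ℕ) : ℝ) + α) / α) := by
            field_simp
          rw [h2, Real.mul_rpow hα.le (by positivity)]
          gcongr
          calc ((((n + 1 : ℕ) : ℝ) + α) / α) ^ (-s.re) ≤ ((n : ℝ) + 2) ^ (-s.re) :=
                Real.rpow_le_rpow_of_nonpos hn h1 (by linarith)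
            _ ≤ ((n : ℝ) + 2) ^ (-(2 : ℝ)) :=
                Real.rpow_le_rpow_of_exponent_le
                  (by linarith [(n.cast_nonneg : (0 : ℝ) ≤ n)]) (by linarith)
            _ = 1 / ((n : ℝ) + 2) ^ 2 := by
                rw [Real.rpow_neg hn.le, one_div]
                norm_num
      _ ≤ _ := by
          rw [← Finset.mul_sum]
          gcongr
          exact sum_one_div_add_two_sq_le N
  have h0 : lerchPartialSum lam α s (N + 1) = ∑ n ∈ Finset.range N,
      lerchCoeff lam (n + 1) / (((n + 1 : ℕ) : ℂ) + (α : ℂ)) ^ s +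
      lerchCoeff lam 0 / (((0 : ℕ) : ℂ) + (α : ℂ)) ^ s := by
    rw [lerchPartialSum, Finset.sum_range_succ']
    rfl
  rw [h0, add_comm]
  have h2 := norm_sub_le_norm_add (lerchCoeff lam 0 / (((0 : ℕ) : ℂ) + (α : ℂ)) ^ s)
    (∑ n ∈ Finset.range N, lerchCoeff lam (n + 1) / (((n + 1 : ℕ) : ℂ) + (α : ℂ)) ^ s)
  rw [hterm 0, Nat.cast_zero, zero_add] at h2
  linarith

/-- The holomorphic companion `G(s) = L(λ, α, s) (s - 1) / (s + 1)` of the Lerch zeta-function,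
with its mean square bound and its lower bound. -/
theorem exists_holomorphic_lerchZeta_mul_sub_one (lam : ℝ) {α : ℝ} (hα : 0 < α) (hα' : α ≤ 1) :
    ∃ G : ℂ → ℂ, Measurable G ∧ DifferentiableOn ℂ G {s | 0 < s.re} ∧
      (∀ s : ℂ, 0 < s.re → s ≠ 1 → lerchZeta lam α s * (s - 1) = G s * (s + 1)) ∧
      (∀ s : ℂ, 2 ≤ s.re → 1 / 9 ≤ ‖G s‖) ∧
      ∀ δ b : ℝ, 0 < δ → ∃ C : ℝ, 0 ≤ C ∧ ∀ T : ℝ, 1 ≤ T → ∀ σ ∈ Set.Icc (1 / 2 + δ) b,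
        ∫⁻ t in Set.Icc (-T) T, ‖G (σ + t * Complex.I)‖ₑ ^ 2 ≤ ENNReal.ofReal (C * T) := by
  classical
  obtain ⟨E, B, hE, hE', hB, hrep⟩ := exists_lerchZeta_mul_sub_one_eq lam hα hα'
  set U : Set ℂ := {s | 0 < s.re} with hU
  have hUo : IsOpen U := isOpen_lt continuous_const Complex.continuous_re
  set H : ℂ → ℂ := fun s => s * mellin (lerchRemainder lam α E) (-s) with hH
  set G₀ : ℂ → ℂ := fun s => ((s - 1) * H s + E) / (s + 1) with hG₀
  have hne : ∀ s ∈ U, s + 1 ≠ 0 := by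
    intro s hs h
    have := congrArg Complex.re h
    simp only [Complex.add_re, Complex.one_re, Complex.zero_re] at this
    have hs' : 0 < s.re := hs
    linarith
  have hHd : ∀ s ∈ U, DifferentiableAt ℂ H s := by
    intro s hs
    have h1 := (mellin_differentiableAt_of_bounded (measurable_lerchRemainder lam α E) hα hB
      (fun x hx => lerchRemainder_eq_zero hα' hx) (s := -s) (by simpa [hU] using hs)).2
    have h2 : DifferentiableAt ℂ (fun z => mellin (lerchRemainder lam α E) (-z)) s :=
      DifferentiableAt.comp (f := fun z : ℂ => -z) s h1 (by fun_prop)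
    exact differentiableAt_id.mul h2
  have hG₀d : DifferentiableOn ℂ G₀ U := by
    intro s hs
    have := hHd s hs
    have h1 := hne s hs
    refine DifferentiableAt.differentiableWithinAt ?_
    fun_prop (disch := assumption)
  set G : ℂ → ℂ := U.piecewise G₀ 0 with hG
  have hGe : Set.EqOn G G₀ U := U.piecewise_eqOn _ _
  have hfun : ∀ s : ℂ, 0 < s.re → s ≠ 1 → lerchZeta lam α s * (s - 1) = G s * (s + 1) := by
    intro s hs hs1
    rw [hGe hs, hrep s hs hs1, hG₀, div_mul_cancel₀ _ (hne s hs)]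
  refine ⟨G, hG₀d.continuousOn.measurable_piecewise continuousOn_const hUo.measurableSet,
    hG₀d.congr hGe, hfun, fun s hs => ?_, fun δ b hδ => ?_⟩
  · have h1 := one_third_le_norm_lerchZeta lam hα hα' hs
    have hs1 : s ≠ 1 := by rintro rfl; norm_num at hs
    have h2 := congrArg norm (hfun s (by linarith) hs1)
    rw [norm_mul, norm_mul] at h2
    have h3 : 1 ≤ ‖s - 1‖ := by
      refine le_trans ?_ (Complex.re_le_norm _)
      rw [Complex.sub_re, Complex.one_re]
      linarith
    -- This factor `3` turns the bound `1/3` for `L` into `1/9` for `G`.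
    have h4 : ‖s + 1‖ ≤ 3 * ‖s - 1‖ := by
      have : ‖s + 1‖ ≤ ‖s - 1‖ + ‖(2 : ℂ)‖ := by
        refine le_trans (le_of_eq ?_) (norm_add_le _ _)
        congr 1
        ring
      rw [Complex.norm_ofNat] at this
      linarith
    have h5 : 1 / 3 * ‖s - 1‖ ≤ ‖G s‖ * (3 * ‖s - 1‖) :=
      calc 1 / 3 * ‖s - 1‖ ≤ ‖lerchZeta lam α s‖ * ‖s - 1‖ := by gcongr
        _ ≤ _ := by rw [h2]; gcongr
    nlinarith
  · obtain ⟨C, hC0, hC⟩ := exists_lintegral_mul_mellin_lerchRemainder_sq_le lam hα hα' hE hE' hB hδ b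
    refine ⟨2 * C + 4, by positivity, fun T hT σ hσ => ?_⟩
    have hpt : ∀ t : ℝ, ‖G (σ + t * Complex.I)‖ₑ ^ 2 ≤
        2 * ‖H (σ + t * Complex.I)‖ₑ ^ 2 + 2 := by
      intro t
      set s : ℂ := (σ : ℂ) + t * Complex.I with hs
      have hre : s.re = σ := by simp [hs]
      have hs0 : 0 < s.re := by rw [hre]; linarith [hσ.1]
      have h1 : ‖s - 1‖ ≤ ‖s + 1‖ := by
        refine le_of_sq_le_sq ?_ (norm_nonneg _)
        rw [Complex.sq_norm, Complex.sq_norm, Complex.normSq_apply, Complex.normSq_apply]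
        simp only [Complex.sub_re, Complex.add_re, Complex.sub_im, Complex.add_im, Complex.one_re,
          Complex.one_im]
        nlinarith
      have h2 : 1 ≤ ‖s + 1‖ := by
        refine le_trans ?_ (Complex.re_le_norm _)
        rw [Complex.add_re, Complex.one_re]
        linarith
      have h3 : ‖G s‖ ≤ ‖H s‖ + 1 := by
        rw [hGe hs0, hG₀]
        simp only [norm_div]
        rw [div_le_iff₀ (by linarith)]
        refine (norm_add_le _ _).trans ?_
        rw [norm_mul, Complex.norm_real, Real.norm_eq_abs, abs_of_nonneg hE]
        nlinarith [norm_nonneg (H s), mul_le_mul_of_nonneg_right h1 (norm_nonneg (H s))]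
      have h4 : ‖G s‖ ^ 2 ≤ 2 * ‖H s‖ ^ 2 + 2 := by
        nlinarith [norm_nonneg (G s), norm_nonneg (H s), sq_nonneg (‖H s‖ - 1)]
      rw [← ofReal_norm, ← ofReal_norm, ← ENNReal.ofReal_pow (norm_nonneg _),
        ← ENNReal.ofReal_pow (norm_nonneg _)]
      refine (ENNReal.ofReal_le_ofReal h4).trans (le_of_eq ?_)
      rw [ENNReal.ofReal_add (by positivity) zero_le_two, ENNReal.ofReal_mul zero_le_two,
        ENNReal.ofReal_ofNat]
    calc _ ≤ ∫⁻ t in Set.Icc (-T) T, (2 * ‖H (σ + t * Complex.I)‖ₑ ^ 2 + 2) :=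
          lintegral_mono hpt
      _ = 2 * (∫⁻ t in Set.Icc (-T) T, ‖H (σ + t * Complex.I)‖ₑ ^ 2) +
          ENNReal.ofReal (4 * T) := by
          rw [lintegral_add_right _ measurable_const,
            lintegral_const_mul' _ _ (by norm_num), setLIntegral_const, Real.volume_Icc,
            ← ENNReal.ofReal_ofNat, ← ENNReal.ofReal_mul zero_le_two]
          congr 2
          ring
      _ ≤ 2 * ENNReal.ofReal (C * T) + ENNReal.ofReal (4 * T) := by
          gcongr
          exact hC T hT σ hσ
      _ = _ := by
          rw [← ENNReal.ofReal_ofNat, ← ENNReal.ofReal_mul zero_le_two,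
            ← ENNReal.ofReal_add (by positivity) (by positivity)]
          congr 1
          ring

/-! ### Return to the Lerch zeta-function. -/

/-- In `Re s > 0` the ratio `|s + 1|/|s - 1|` lies between `1` and `1 + 2/|Im s|`, so passing from
`G` to `L` costs only a logarithmic singularity at height `0`. -/
theorem abs_log_norm_le_of_mul_sub_one_eq {z w s : ℂ} (hs : 0 < s.re) (him : s.im ≠ 0)
    (h : z * (s - 1) = w * (s + 1)) :
    |Real.log ‖z‖| ≤ |Real.log ‖w‖| + Real.log (1 + 2 / |s.im|) := by
  have hi : 0 < |s.im| := abs_pos.2 him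
  have h1 : |s.im| ≤ ‖s - 1‖ := by
    have := Complex.abs_im_le_norm (s - 1)
    simpa using this
  have h2 : |s.im| ≤ ‖s + 1‖ := by
    have := Complex.abs_im_le_norm (s + 1)
    simpa using this
  have h3 : ‖s - 1‖ ≤ ‖s + 1‖ := by
    refine le_of_sq_le_sq ?_ (norm_nonneg _)
    rw [Complex.sq_norm, Complex.sq_norm, Complex.normSq_apply, Complex.normSq_apply]
    simp only [Complex.sub_re, Complex.add_re, Complex.sub_im, Complex.add_im, Complex.one_re,
      Complex.one_im]
    nlinarith
  have hp1 : 0 < ‖s - 1‖ := hi.trans_le h1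
  have hp2 : 0 < ‖s + 1‖ := hi.trans_le h2
  have h4 : ‖s + 1‖ / ‖s - 1‖ ≤ 1 + 2 / |s.im| := by
    have h5 : ‖s + 1‖ ≤ ‖s - 1‖ + 2 := by
      have : ‖s + 1‖ ≤ ‖s - 1‖ + ‖(2 : ℂ)‖ := by
        refine le_trans (le_of_eq ?_) (norm_add_le _ _)
        congr 1
        ring
      rwa [Complex.norm_ofNat] at this
    calc ‖s + 1‖ / ‖s - 1‖ ≤ (‖s - 1‖ + 2) / ‖s - 1‖ := by gcongr
      _ = 1 + 2 / ‖s - 1‖ := by field_simp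
      _ ≤ _ := by gcongr
  have hlog : |Real.log (‖s + 1‖ / ‖s - 1‖)| ≤ Real.log (1 + 2 / |s.im|) := by
    rw [abs_of_nonneg (Real.log_nonneg ((one_le_div hp1).2 h3))]
    gcongr
  have e : ‖z‖ = ‖w‖ * (‖s + 1‖ / ‖s - 1‖) := by
    have := congrArg norm h
    rw [norm_mul, norm_mul] at this
    rw [← mul_div_assoc, ← this]
    field_simp
  rcases eq_or_ne ‖w‖ 0 with h0 | h0
  · rw [e, h0, zero_mul, Real.log_zero, abs_zero, zero_add]
    exact (abs_nonneg _).trans hlog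
  · rw [e, Real.log_mul h0 (by positivity)]
    refine (abs_add_le _ _).trans ?_
    gcongr

theorem mainTheorem6 (lam α σ₁ ε₁ : ℝ) (hα : 0 < α) (hα' : α ≤ 1) (hσ₁ : 0 < σ₁)
    (hε₁ : 0 < ε₁) :
    ∃ T₀ : ℝ, 0 < T₀ ∧ ∃ C : ℝ, 0 < C ∧
      ∀ T : ℝ, T₀ ≤ T → ∀ σ : ℝ, 1 / 2 + ε₁ ≤ σ → σ ≤ σ₁ →
        IntervalIntegrable
          (fun t : ℝ => Real.log ‖lerchZeta lam α ((σ : ℂ) + (t : ℂ) * Complex.I)‖ ^ 2)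
          MeasureTheory.volume 0 T ∧
        ∫ t in (0 : ℝ)..T,
          Real.log ‖lerchZeta lam α ((σ : ℂ) + (t : ℂ) * Complex.I)‖ ^ 2 ≤ C * T := by
  obtain ⟨G, hGm, hGd, hfun, hlow, hms⟩ := exists_holomorphic_lerchZeta_mul_sub_one lam hα hα'
  -- The flat-disc geometry requires `ε ≤ 1`, hence the minimum.
  obtain ⟨C, hC0, hC⟩ := exists_lintegral_log_sq_le hGm hGd (by norm_num : (0 : ℝ) < 1 / 9) hlow hms
    (ε := min ε₁ 1) (σ₁ := σ₁) (lt_min hε₁ one_pos) (min_le_right _ _)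
  obtain ⟨K, hK0, hK⟩ := exists_eLpNorm_log_one_add_div_le (C := 2) zero_le_two
  -- The `4` comes from `(x + y)² ≤ 2(x² + y²)` and `⌈T⌉ ≤ 2T`; the `+ 1` only makes the constant
  -- positive.
  refine ⟨1, one_pos, 4 * (C + K ^ 2) + 1, by positivity, fun T hT σ hσ hσ' => ?_⟩
  have hT0 : 0 < T := by linarith
  have hσ0 : 0 < σ := by linarith
  set N : ℕ := ⌈T⌉₊ with hN
  have hTN : T ≤ N := Nat.le_ceil _
  have hNT : (N : ℝ) ≤ 2 * T := by
    have := (Nat.ceil_lt_add_one hT0.le).le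
    linarith
  have hN1 : 1 ≤ N := by
    have : (1 : ℝ) ≤ N := hT.trans hTN
    exact_mod_cast this
  set f : ℝ → ℝ := fun t => Real.log ‖lerchZeta lam α ((σ : ℂ) + (t : ℂ) * Complex.I)‖ with hf
  set F : ℝ → ℝ := fun t => Real.log ‖G ((σ : ℂ) + (t : ℂ) * Complex.I)‖ with hF
  have hre : ∀ t : ℝ, ((σ : ℂ) + (t : ℂ) * Complex.I).re = σ := by intro t; simp
  have him : ∀ t : ℝ, ((σ : ℂ) + (t : ℂ) * Complex.I).im = t := by intro t; simp
  have hne1 : ∀ t : ℝ, t ≠ 0 → (σ : ℂ) + (t : ℂ) * Complex.I ≠ 1 := by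
    intro t ht h
    have := congrArg Complex.im h
    rw [him, Complex.one_im] at this
    exact ht this
  -- Measurability is inherited from `G`, through which `L` is expressed off `t = 0`.
  have hfm : AEStronglyMeasurable f volume := by
    have hm : Measurable fun t : ℝ => Real.log ‖G ((σ : ℂ) + (t : ℂ) * Complex.I) *
        (((σ : ℂ) + (t : ℂ) * Complex.I) + 1) / (((σ : ℂ) + (t : ℂ) * Complex.I) - 1)‖ := by
      fun_prop
    refine hm.aestronglyMeasurable.congr ?_
    filter_upwards [Measure.ae_ne volume (0 : ℝ)] with t ht
    rw [hf, ← hfun _ (by rw [hre]; exact hσ0) (hne1 t ht),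
      mul_div_cancel_right₀ _ (sub_ne_zero.2 (hne1 t ht))]
  have hpt : ∀ᵐ t : ℝ ∂volume, ‖f t‖ₑ ^ 2 ≤
      2 * (‖F t‖ₑ ^ 2 + ‖Real.log (1 + 2 / |t - 0|)‖ₑ ^ 2) := by
    filter_upwards [Measure.ae_ne volume (0 : ℝ)] with t ht
    have h1 := abs_log_norm_le_of_mul_sub_one_eq (by rw [hre]; exact hσ0)
      (by rw [him]; exact ht) (hfun _ (by rw [hre]; exact hσ0) (hne1 t ht))
    rw [him] at h1
    have h2 : ‖f t‖ ^ 2 ≤ 2 * (‖F t‖ ^ 2 + ‖Real.log (1 + 2 / |t - 0|)‖ ^ 2) := by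
      have h3 : ‖f t‖ ≤ ‖F t‖ + ‖Real.log (1 + 2 / |t - 0|)‖ := by
        rw [sub_zero]
        exact h1.trans (add_le_add le_rfl (Real.le_norm_self _))
      refine (pow_le_pow_left₀ (norm_nonneg _) h3 2).trans ?_
      exact add_sq_le
    simp only [← ofReal_norm]
    rw [← ENNReal.ofReal_pow (norm_nonneg _), ← ENNReal.ofReal_pow (norm_nonneg _),
      ← ENNReal.ofReal_pow (norm_nonneg _), ← ENNReal.ofReal_add (by positivity) (by positivity),
      ← ENNReal.ofReal_ofNat, ← ENNReal.ofReal_mul zero_le_two]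
    exact ENNReal.ofReal_le_ofReal h2
  have hlogm : Measurable fun t : ℝ => ‖Real.log (1 + 2 / |t - 0|)‖ₑ ^ 2 := by fun_prop
  have hlogb : ∫⁻ t in Set.Icc (0 : ℝ) N, ‖Real.log (1 + 2 / |t - 0|)‖ₑ ^ 2 ≤
      ENNReal.ofReal (K ^ 2 * N) := by
    refine (lintegral_Icc_zero_natCast_le_sum _ N).trans ?_
    calc _ ≤ ∑ n ∈ Finset.range N, ENNReal.ofReal K ^ 2 :=
          Finset.sum_le_sum fun n _ => lintegral_enorm_sq_le_of_eLpNorm_le (hK n 0)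
      _ = _ := by
          rw [Finset.sum_const, Finset.card_range, nsmul_eq_mul, mul_comm (K ^ 2),
            ENNReal.ofReal_mul (by positivity), ENNReal.ofReal_natCast, ENNReal.ofReal_pow hK0]
  have hFb := hC N hN1 σ ⟨by linarith [min_le_left ε₁ 1], hσ'⟩
  have htot : ∫⁻ t in Set.Ioc (0 : ℝ) T, ‖f t ^ 2‖ₑ ≤ ENNReal.ofReal (4 * (C + K ^ 2) * T) := by
    calc _ ≤ ∫⁻ t in Set.Icc (0 : ℝ) N, ‖f t‖ₑ ^ 2 := by
          simp only [enorm_pow]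
          exact lintegral_mono_set (Set.Ioc_subset_Icc_self.trans (Set.Icc_subset_Icc_right hTN))
      _ ≤ ∫⁻ t in Set.Icc (0 : ℝ) N, 2 * (‖F t‖ₑ ^ 2 + ‖Real.log (1 + 2 / |t - 0|)‖ₑ ^ 2) :=
          lintegral_mono_ae (ae_restrict_of_ae hpt)
      _ ≤ 2 * (ENNReal.ofReal (C * N) + ENNReal.ofReal (K ^ 2 * N)) := by
          rw [lintegral_const_mul' _ _ (by norm_num), lintegral_add_right _ hlogm]
          gcongr
      _ ≤ _ := by
          rw [← ENNReal.ofReal_add (by positivity) (by positivity), ← ENNReal.ofReal_ofNat,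
            ← ENNReal.ofReal_mul zero_le_two]
          apply ENNReal.ofReal_le_ofReal
          have : (C + K ^ 2) * N ≤ (C + K ^ 2) * (2 * T) := by gcongr
          linarith
  have hint : IntegrableOn (fun t => f t ^ 2) (Set.Ioc 0 T) :=
    ⟨(hfm.pow 2).restrict, htot.trans_lt ENNReal.ofReal_lt_top⟩
  refine ⟨(intervalIntegrable_iff_integrableOn_Ioc_of_le hT0.le).2 hint, ?_⟩
  rw [intervalIntegral.integral_of_le hT0.le, integral_eq_lintegral_of_nonneg_ae
    (Eventually.of_forall fun t => sq_nonneg _) hint.1]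
  refine ENNReal.toReal_le_of_le_ofReal (by positivity) ?_
  have e : ∀ t, ENNReal.ofReal (f t ^ 2) = ‖f t ^ 2‖ₑ := fun t =>
    (Real.enorm_eq_ofReal (sq_nonneg _)).symm
  simp only [e]
  refine htot.trans (ENNReal.ofReal_le_ofReal ?_)
  linarith
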